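/- **Setting.** Let $d\ge 0$ and $N,M,K\ge 1$ be integers, let $(x_i,y_i)$, $i\in I=\{0,\dots,N-1\}$, be data with $x_i\in\mathbb{R}^d$ and $y_i\in\{-1,+1\}$, and let $I=\biguplus_{m=0}^{M-1} I_m$ be a partition of the indices into $M$ tasks. Let $\ell:\mathbb{R}\to\mathbb{R}$ be differentiable, and let $\mathcal{L}_m(w)=\sum_{i\in I_m}\ell(y_i x_i^\top w)$ be the loss of task $m$. Cyclic sequential gradient descent with learning rate $\eta>0$ and any initial point $w_0^{(0)}\in\mathbb{R}^d$ is, for stages $t=0,1,2,\dots$, $$w^{(t)}_{k+1}=w^{(t)}_k-\eta\nabla\mathcal{L}_{t \bmod M}(w^{(t)}_k)\quad(0\le k\le K-1),\qquad w^{(t+1)}_0=w^{(t)}_K .$$ **Assumptions.** 1. (Joint separability) There is $w\in\mathbb{R}^d$ with $y_i x_i^\top w>0$ for all $i\in I$. Let $\hat w$ be the joint (offline) $\ell_2$ max-margin solution, that is, the unique minimizer of $\|w\|^2$ subject to $y_i x_i^\top w\ge 1$ for all $i\in I$; let $\phi=\min_{i\in I} y_i x_i^\top\hat w/\|\hat w\|$,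 and let $S=\{i\in I: y_i x_i^\top\hat w/\|\hat w\|=\phi\}$ be the set of indices of support vectors. 2. (Non-degenerate support vectors) There are unique coefficients $\alpha_i>0$ ($i\in S$) with $\hat w=\sum_{i\in S}\alpha_i y_i x_i$. 3. (Shape of the loss) $\ell(u)>0$ and $\ell'(u)<0$ for all $u$, $\lim_{u\to+\infty}\ell(u)=0$, $\ell'$ is $\beta$-Lipschitz, and $\limsup_{u\to-\infty}\ell'(u)<0$. 4. (Tight exponential tail) There are positive constants $\mu_+,\mu_-,\bar u$ such that for all $u>\bar u$ $$(1-e^{-\mu_- u})e^{-u}\le-\ell'(u)\le(1+e^{-\mu_+ u})e^{-u}.$$ 5. (Learning rate) With $X\in\mathbb{R}^{d\times N}$ the matrix with columns $x_i$ and $\sigma_{\max}=\sqrt{\lambda_{\max}(XX^\top)}$, $$0<\eta<\frac{\phi^2}{2K\beta\sigma_{\max}^3(M\phi+\sigma_{\max})}.$$ **Theorem.** Under these assumptions, for all sufficiently large $t$ and all $k\in\{0,\dots,K-1\}$, $$w^{(t)}_k=\ln(t)\,\hat w+\rho^{(t)}_k,$$ where $\|\rho^{(t)}_k\|$ stays bounded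 as $t\to\infty$. Consequently, for every $k\in\{0,\dots,K-1\}$, $$\lim_{t\to\infty}\frac{w^{(t)}_k}{\|w^{(t)}_k\|}=\frac{\hat w}{\|\hat w\|}.$$ -/

import Mathlib

open Filter Topology

noncomputable section

/-- `ℝ^d` with the Euclidean norm and inner product. -/
abbrev Vec (d : ℕ) : Type := EuclideanSpace ℝ (Fin d)

/-! ### Tasks, losses and sequential gradient descent -/

/-- The index set `I = [0 : N-1]` is the disjoint union of the task index sets `I_m`. -/
def IsTaskPartition {N M : ℕ} (I : Fin M → Finset (Fin N)) : Prop :=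
  ∀ i : Fin N, ∃! m : Fin M, i ∈ I m

/-- The training loss `∑_{i ∈ J} ℓ (y_i x_iᵀ w)` on the data with indices in `J`. -/
def trainLoss {d N : ℕ} (loss : ℝ → ℝ) (x : Fin N → Vec d) (y : Fin N → ℝ)
    (J : Finset (Fin N)) (w : Vec d) : ℝ :=
  ∑ i ∈ J, loss (y i * inner ℝ (x i) w)

/-- One step of gradient descent on `f` with learning rate `η`. -/
def gdStep {d : ℕ} (η : ℝ) (f : Vec d → ℝ) (w : Vec d) : Vec d :=
  w - η • gradient f w

/-- `K` steps of gradient descent are run on each stage loss `L t`, `t = 0, 1, 2, …`, every stage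
starting from the last iterate of the stage before; this is `w_0^{(t)}`. -/
def stageStart {d : ℕ} (η : ℝ) (K : ℕ) (L : ℕ → Vec d → ℝ) (w₀ : Vec d) : ℕ → Vec d
  | 0 => w₀
  | t + 1 => (gdStep η (L t))^[K] (stageStart η K L w₀ t)

/-- The iterate `w_k^{(t)}` of sequential gradient descent. -/
def seqGD {d : ℕ} (η : ℝ) (K : ℕ) (L : ℕ → Vec d → ℝ) (w₀ : Vec d) (t k : ℕ) : Vec d :=
  (gdStep η (L t))^[k] (stageStart η K L w₀ t)

/-- The cyclic task order `m_t = t mod M`. -/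
def cyclicTask (M : ℕ) [NeZero M] (t : ℕ) : Fin M :=
  ⟨t % M, Nat.mod_lt t (NeZero.pos M)⟩

/-- The iterate `w_k^{(t)}` of sequential gradient descent on the tasks `I_0, …, I_{M-1}`
presented cyclically. -/
def cyclicGD {d N M : ℕ} [NeZero M] (loss : ℝ → ℝ) (x : Fin N → Vec d) (y : Fin N → ℝ)
    (I : Fin M → Finset (Fin N)) (η : ℝ) (K : ℕ) (w₀ : Vec d) (t k : ℕ) : Vec d :=
  seqGD η K (fun s => trainLoss loss x y (I (cyclicTask M s))) w₀ t k

/-! ### Assumptions on the loss -/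

/-- The loss is differentiable, positive, decreasing to zero (with negative derivative),
`β`-smooth (its derivative is `β`-Lipschitz), and `limsup_{u → -∞} ℓ'(u) < 0`. The upper limit is
taken in the extended reals, since `ℓ'` need not be bounded below. -/
structure LossShape (loss : ℝ → ℝ) (β : ℝ) : Prop where
  differentiable : Differentiable ℝ loss
  pos : ∀ u, 0 < loss u
  deriv_neg : ∀ u, deriv loss u < 0
  tendsto_zero : Tendsto loss atTop (𝓝 0)
  smooth : ∀ u v, |deriv loss u - deriv loss v| ≤ β * |u - v|
  limsup_neg : limsup (fun u : ℝ => ((deriv loss u : ℝ) : EReal)) atBot < 0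

/-- The negative derivative of the loss has a tight exponential tail. -/
def TightExponentialTail (loss : ℝ → ℝ) : Prop :=
  ∃ μp μm ub : ℝ, 0 < μp ∧ 0 < μm ∧ 0 < ub ∧ ∀ u, ub < u →
    (1 - Real.exp (-μm * u)) * Real.exp (-u) ≤ -deriv loss u ∧
      -deriv loss u ≤ (1 + Real.exp (-μp * u)) * Real.exp (-u)

/-! ### Separability, maximum margin, support vectors -/

/-- The total dataset is linearly separable. -/
def JointlySeparable {d N : ℕ} (x : Fin N → Vec d) (y : Fin N → ℝ) : Prop :=
  ∃ w : Vec d, ∀ i, 0 < y i * inner ℝ (x i) w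

/-- `w` minimizes `‖w‖²` subject to `y_i x_iᵀ w ≥ 1` for all `i`. -/
def IsMaxMargin {d N : ℕ} (x : Fin N → Vec d) (y : Fin N → ℝ) (w : Vec d) : Prop :=
  (∀ i, 1 ≤ y i * inner ℝ (x i) w) ∧
    ∀ v : Vec d, (∀ i, 1 ≤ y i * inner ℝ (x i) v) → ‖w‖ ^ 2 ≤ ‖v‖ ^ 2

theorem existsUnique_isMaxMargin {d N : ℕ} {x : Fin N → Vec d} {y : Fin N → ℝ}
    (h : JointlySeparable x y) : ∃! w, IsMaxMargin x y w := by
  obtain ⟨w, hw⟩ := h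
  let C : Set (Vec d) := {v | ∀ i, 1 ≤ y i * inner ℝ (x i) v}
  have hC : IsClosed C := by
    have : C = ⋂ i, {v : Vec d | 1 ≤ y i * inner ℝ (x i) v} := by
      ext v; simp [C]
    rw [this]
    exact isClosed_iInter fun i => isClosed_le (by fun_prop) (by fun_prop)
  have hne : C.Nonempty := by
    refine ⟨(∑ j, (y j * inner ℝ (x j) w)⁻¹) • w, fun i => ?_⟩
    rw [inner_smul_right]
    have h1 : (y i * inner ℝ (x i) w)⁻¹ ≤ ∑ j, (y j * inner ℝ (x j) w)⁻¹ :=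
      Finset.single_le_sum (f := fun j => (y j * inner ℝ (x j) w)⁻¹)
        (fun j _ => (inv_pos.2 (hw j)).le) (Finset.mem_univ i)
    have h2 := mul_le_mul_of_nonneg_right h1 (hw i).le
    rw [inv_mul_cancel₀ (hw i).ne'] at h2
    linarith
  obtain ⟨v, hv, hd⟩ := hC.exists_infDist_eq_dist hne (0 : Vec d)
  have hmin : ∀ u ∈ C, ‖v‖ ≤ ‖u‖ := by
    intro u hu
    have := Metric.infDist_le_dist_of_mem (x := (0 : Vec d)) hu
    rw [hd] at this
    simpa using this
  refine ⟨v, ⟨hv, fun u hu => ?_⟩, fun u hu => ?_⟩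
  · have := hmin u hu
    gcongr
  · have h1 : ‖u‖ ^ 2 ≤ ‖v‖ ^ 2 := hu.2 v hv
    have hmid : (1 / 2 : ℝ) • (u + v) ∈ C := by
      intro i
      have a := hu.1 i
      have b := hv i
      rw [inner_smul_right, inner_add_right]
      linarith
    have h2 := hmin _ hmid
    rw [norm_smul, Real.norm_of_nonneg (by norm_num)] at h2
    have h3 := parallelogram_law_with_norm ℝ u v
    have h4 : ‖u - v‖ = 0 := by
      nlinarith [norm_nonneg (u - v), norm_nonneg (u + v), norm_nonneg v]
    exact sub_eq_zero.1 (norm_eq_zero.1 h4)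

/-- The joint `ℓ²` max-margin solution `ŵ`: under joint separability, the unique minimizer. -/
def maxMargin {d N : ℕ} (x : Fin N → Vec d) (y : Fin N → ℝ) : Vec d :=
  Classical.epsilon (IsMaxMargin x y)

theorem maxMargin_spec {d N : ℕ} {x : Fin N → Vec d} {y : Fin N → ℝ}
    (h : JointlySeparable x y) : IsMaxMargin x y (maxMargin x y) :=
  Classical.epsilon_spec (existsUnique_isMaxMargin h).exists

/-- The maximum margin `φ = min_i y_i x_iᵀ ŵ / ‖ŵ‖` (a minimum over a finite set). -/
def margin {d N : ℕ} (x : Fin N → Vec d) (y : Fin N → ℝ) : ℝ :=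
  ⨅ i, y i * inner ℝ (x i) (maxMargin x y) / ‖maxMargin x y‖

/-- The index set `S` of the support vectors: the data points attaining the maximum margin. -/
def supportIdx {d N : ℕ} (x : Fin N → Vec d) (y : Fin N → ℝ) : Finset (Fin N) :=
  Finset.univ.filter fun i =>
    y i * inner ℝ (x i) (maxMargin x y) / ‖maxMargin x y‖ = margin x y

/-- There are unique positive coefficients `α_i`, `i ∈ S`, with `ŵ = ∑_{i ∈ S} α_i y_i x_i`. -/
def NonDegenerateSupport {d N : ℕ} (x : Fin N → Vec d) (y : Fin N → ℝ) : Prop :=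
  ∃! α : supportIdx x y → ℝ,
    (∀ i, 0 < α i) ∧ maxMargin x y = ∑ i : supportIdx x y, (α i * y i) • x i

/-- The `d × N` data matrix, whose columns are the `x_i`. -/
def dataMatrix {d N : ℕ} (x : Fin N → Vec d) : Matrix (Fin d) (Fin N) ℝ :=
  Matrix.of fun j i => x i j

/-- `σ_max`, the square root of the largest eigenvalue of `X Xᵀ`. -/
def sigmaMax {d N : ℕ} (x : Fin N → Vec d) : ℝ :=
  √(sSup {l : ℝ | Module.End.HasEigenvalue
    (Matrix.toLin' (dataMatrix x * (dataMatrix x).transpose)) l})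

end

/-!
Write `z i = y i • x i`, so that the loss of a set of data is `∑ loss ⟪z i, w⟫` and every gradient is
a combination of the `z i` with negative coefficients. The sequence is studied at the starts `u n` of
the cycles of `M` stages: `u (n + 1) = u n + η • ∑ i, c n i • z i`, where `c n i` is the sum of
`-loss'` over the `K` steps of the cycle whose task contains `i`.

*Divergence of the margins.* Because `c n` is nonnegative, the margin gives
`φ ∑ i, c n i ≤ ‖∑ i, c n i • z i‖`. Thus the whole cycle takes place within a multiple of its net
displacement, no cancellation between tasks can occur, and for the given learning rates the joint loss
decreases by a multiple of `‖u (n + 1) - u n‖²` (`LossShape.cycle_descent`). Hence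
`δ n = ∑ i, c n i` is square summable, the derivatives of the loss at the iterates tend to zero, and
all margins `⟪z i, u n⟫` tend to infinity.

*Growth.* By the tail of the loss, `c n i = K exp (-⟪z i, u n⟫)` up to
`O(δ n ² + exp (-(1 + μ) ⟪z i, u n⟫))` (`eventually_abs_sum_sub_mul_exp_neg_le`). The coefficients of
the max-margin solution `ŵ` are `η K exp (-⟪z i, v⟫)` for some `v`, by linear independence of the
support vectors (`NonDegenerateSupport.exists_dual_certificate`). For the residual
`r n = u n - log (n + 1) • ŵ - v` with `s = ⟪z i, r n⟫`, a support vector contributes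
`(α i / (n + 1)) (exp (-s) - 1) s ≤ 0` to `⟪r (n + 1) - r n, r n⟫`, and everything else is summable
or summable times `‖r n‖`. So `‖r n‖²` satisfies a Grönwall inequality with summable coefficients and
is bounded (`exists_norm_sub_log_smul_le`). Within a cycle the iterates move by a bounded amount, and
`log (t / M + 1)` differs from `log t` by a bounded amount, which gives the bound at every stage; the
direction of the iterates is then that of `ŵ`.
-/

/-! ### Scalar inequalities -/

/-- A discrete Grönwall lemma: `V (n + 1) ≤ (1 + b n) V n + a n` with summable `a, b ≥ 0` bounds `V`,
because `V n ≤ exp (∑ b) (V 0 + ∑ a)`. -/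
theorem exists_bound_of_le_one_add_mul_add {V a b : ℕ → ℝ} (hV : ∀ n, 0 ≤ V n)
    (ha : ∀ n, 0 ≤ a n) (hb : ∀ n, 0 ≤ b n) (hsa : Summable a) (hsb : Summable b)
    (h : ∀ᶠ n in atTop, V (n + 1) ≤ (1 + b n) * V n + a n) : ∃ B, ∀ n, V n ≤ B := by
  obtain ⟨m, hm⟩ := eventually_atTop.1 h
  have key : ∀ n, V (m + n) ≤ Real.exp (∑ j ∈ Finset.range n, b (m + j)) *
      (V m + ∑ j ∈ Finset.range n, a (m + j)) := by
    intro n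
    induction n with
    | zero => simp
    | succ n ih =>
      rw [Finset.sum_range_succ, Finset.sum_range_succ, Real.exp_add]
      set E := Real.exp (∑ j ∈ Finset.range n, b (m + j))
      set A := ∑ j ∈ Finset.range n, a (m + j)
      have hA : 0 ≤ A := Finset.sum_nonneg fun j _ => ha _
      have hE : 1 ≤ E := Real.one_le_exp (Finset.sum_nonneg fun j _ => hb _)
      have h1 : 1 + b (m + n) ≤ Real.exp (b (m + n)) := by
        linarith [Real.add_one_le_exp (b (m + n))]
      have hE' : 1 ≤ Real.exp (b (m + n)) := Real.one_le_exp (hb _)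
      have hVA : 0 ≤ E * (V m + A) := mul_nonneg (by linarith) (add_nonneg (hV m) hA)
      calc V (m + (n + 1)) ≤ (1 + b (m + n)) * V (m + n) + a (m + n) := hm (m + n) (by omega)
        _ ≤ Real.exp (b (m + n)) * (E * (V m + A)) + 1 * a (m + n) := by
            rw [one_mul]
            gcongr
            exact hV _
        _ ≤ Real.exp (b (m + n)) * (E * (V m + A)) +
            (E * Real.exp (b (m + n))) * a (m + n) := by
            gcongr
            · exact ha _
            · nlinarith
        _ = _ := by ring
  have hsa' : Summable fun j => a (m + j) := by
    simpa [add_comm] using (summable_nat_add_iff m).2 hsa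
  have hsb' : Summable fun j => b (m + j) := by
    simpa [add_comm] using (summable_nat_add_iff m).2 hsb
  have bound : ∀ n, V (m + n) ≤ Real.exp (∑' j, b (m + j)) * (V m + ∑' j, a (m + j)) := by
    intro n
    refine (key n).trans ?_
    gcongr
    · exact add_nonneg (hV m) (Finset.sum_nonneg fun j _ => ha _)
    · exact hsb'.sum_le_tsum _ fun j _ => hb _
    · exact hsa'.sum_le_tsum _ fun j _ => ha _
  refine ⟨max (Real.exp (∑' j, b (m + j)) * (V m + ∑' j, a (m + j)))
    (∑ j ∈ Finset.range m, V j), fun n => ?_⟩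
  rcases lt_or_ge n m with hn | hn
  · exact le_max_of_le_right
      (Finset.single_le_sum (f := V) (fun j _ => hV j) (Finset.mem_range.2 hn))
  · obtain ⟨j, rfl⟩ := Nat.exists_eq_add_of_le hn
    exact le_max_of_le_left (bound j)

theorem summable_exp_neg_mul_log {p : ℝ} (hp : 1 < p) :
    Summable fun n : ℕ => Real.exp (-p * Real.log (n + 1)) := by
  have h := (summable_nat_add_iff 1).2 (Real.summable_nat_rpow_inv.2 hp)
  refine h.congr fun n => ?_
  have hn : (0 : ℝ) < n + 1 := by positivity
  push_cast
  rw [Real.rpow_def_of_pos hn, ← Real.exp_neg]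
  ring_nf

theorem mul_exp_neg_le_one (s : ℝ) : s * Real.exp (-s) ≤ 1 := by
  have h := Real.add_one_le_exp s
  have h2 : Real.exp s * Real.exp (-s) = 1 := by rw [← Real.exp_add]; simp
  nlinarith [Real.exp_pos (-s)]

theorem exp_neg_sub_one_mul_nonpos (s : ℝ) : (Real.exp (-s) - 1) * s ≤ 0 := by
  rcases le_total 0 s with hs | hs
  · have : Real.exp (-s) ≤ 1 := Real.exp_le_one_iff.2 (by linarith)
    nlinarith
  · have : 1 ≤ Real.exp (-s) := Real.one_le_exp (by linarith)
    nlinarith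

/-- The contribution of one support vector to the drift of `‖r‖²`. Here `r` is the residual,
`s = ⟪z_i, r⟫`, `l = log (n + 1)`, `c = ⟪z_i, v⟫` and `q = s + l + c` is the current margin. The
leading part of the left side is a nonnegative multiple of `(e^{-s} - 1) s ≤ 0`. The error
`e^{-(1+μ)q} |s|` is summable in `n` when `s ≥ -1`, and is absorbed by the leading part when
`s < -1`. -/
theorem support_drift_le {η K C c μ s l q h ε : ℝ} (hη : 0 < η) (hK : 0 < K) (hC : 0 ≤ C)
    (hμ : 0 < μ) (hq : q = s + l + c)
    (hh : |h - K * Real.exp (-q)| ≤ C * (ε + Real.exp (-(1 + μ) * q)))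
    (hsmall : C * Real.exp (-μ * q) ≤ K / 2) :
    (η * h - η * K * Real.exp (-c) * Real.exp (-l)) * s ≤
      η * C * ε * |s| +
        η * C * Real.exp (-(1 + μ) * c) * Real.exp (1 + μ) * Real.exp (-(1 + μ) * l) := by
  have e1 : Real.exp (-q) = Real.exp (-c) * Real.exp (-l) * Real.exp (-s) := by
    rw [hq, ← Real.exp_add, ← Real.exp_add]; ring_nf
  have e2 : Real.exp (-(1 + μ) * q) =
      Real.exp (-(1 + μ) * c) * Real.exp (-(1 + μ) * l) * Real.exp (-(1 + μ) * s) := by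
    rw [hq, ← Real.exp_add, ← Real.exp_add]; ring_nf
  have e3 : Real.exp (-(1 + μ) * q) = Real.exp (-μ * q) * Real.exp (-q) := by
    rw [← Real.exp_add]; ring_nf
  have herr : (h - K * Real.exp (-q)) * s ≤ C * (ε + Real.exp (-(1 + μ) * q)) * |s| := by
    calc (h - K * Real.exp (-q)) * s ≤ |(h - K * Real.exp (-q)) * s| := le_abs_self _
      _ = |h - K * Real.exp (-q)| * |s| := abs_mul _ _
      _ ≤ _ := by gcongr
  set a := Real.exp (-c) * Real.exp (-l) with ha
  have hapos : 0 < a := by positivity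
  have hmain : (η * h - η * K * Real.exp (-c) * Real.exp (-l)) * s ≤
      η * K * a * ((Real.exp (-s) - 1) * s) + η * C * ε * |s| +
        η * C * Real.exp (-(1 + μ) * q) * |s| := by
    have := mul_le_mul_of_nonneg_left herr hη.le
    rw [e1] at this
    nlinarith
  refine hmain.trans ?_
  suffices η * K * a * ((Real.exp (-s) - 1) * s) + η * C * Real.exp (-(1 + μ) * q) * |s| ≤
    η * C * Real.exp (-(1 + μ) * c) * Real.exp (1 + μ) * Real.exp (-(1 + μ) * l) by linarith
  rcases le_or_gt (-1) s with hs | hs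
  · have h1 : Real.exp (-(1 + μ) * s) * |s| ≤ Real.exp (1 + μ) := by
      rcases le_total 0 s with h0 | h0
      · rw [abs_of_nonneg h0]
        calc Real.exp (-(1 + μ) * s) * s ≤ Real.exp (-s) * s := by
              gcongr; nlinarith
          _ ≤ 1 := by rw [mul_comm]; exact mul_exp_neg_le_one s
          _ ≤ _ := Real.one_le_exp (by linarith)
      · rw [abs_of_nonpos h0]
        calc Real.exp (-(1 + μ) * s) * -s ≤ Real.exp (1 + μ) * 1 :=
              mul_le_mul (Real.exp_le_exp.2 (by nlinarith)) (by linarith) (by linarith)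
                (Real.exp_pos _).le
          _ = _ := mul_one _
    have h2 : η * K * a * ((Real.exp (-s) - 1) * s) ≤ 0 :=
      mul_nonpos_of_nonneg_of_nonpos (by positivity) (exp_neg_sub_one_mul_nonpos s)
    have h3 : η * C * Real.exp (-(1 + μ) * q) * |s| ≤
        η * C * Real.exp (-(1 + μ) * c) * Real.exp (1 + μ) * Real.exp (-(1 + μ) * l) := by
      rw [e2]
      calc _ = η * C * Real.exp (-(1 + μ) * c) * Real.exp (-(1 + μ) * l) *
            (Real.exp (-(1 + μ) * s) * |s|) := by ring
        _ ≤ η * C * Real.exp (-(1 + μ) * c) * Real.exp (-(1 + μ) * l) * Real.exp (1 + μ) := by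
            gcongr
        _ = _ := by ring
    linarith
  · have hs2 : 2 ≤ Real.exp (-s) := by linarith [Real.add_one_le_exp (-s)]
    have h3 : η * C * Real.exp (-(1 + μ) * q) * |s| ≤ η * (K / 2) * (a * Real.exp (-s)) * (-s) := by
      rw [abs_of_neg (by linarith), e3, e1]
      calc _ = η * (C * Real.exp (-μ * q)) * (a * Real.exp (-s)) * (-s) := by ring
        _ ≤ _ := by
          gcongr
          linarith
    have h4 : η * K * a * ((Real.exp (-s) - 1) * s) + η * (K / 2) * (a * Real.exp (-s)) * (-s) ≤ 0 := by
      have : η * K * a * ((Real.exp (-s) - 1) * s) + η * (K / 2) * (a * Real.exp (-s)) * (-s)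
          = -(η * K * a * (-s) * (Real.exp (-s) / 2 - 1)) := by ring
      rw [this, neg_nonpos]
      have : 0 ≤ Real.exp (-s) / 2 - 1 := by linarith
      have : 0 ≤ -s := by linarith
      positivity
    have : 0 ≤ η * C * Real.exp (-(1 + μ) * c) * Real.exp (1 + μ) * Real.exp (-(1 + μ) * l) := by
      positivity
    linarith

/-- The contribution to the drift of a point that is not a support vector: its margin along the
max-margin direction grows like `θ l` with `θ > 1`, so the contribution is summable. -/
theorem nonsupport_drift_le {η C c θ s l q h : ℝ} (hη : 0 < η) (hC : 0 ≤ C)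
    (hq : q = s + θ * l + c) (h0 : 0 ≤ h) (hh : h ≤ C * Real.exp (-q)) :
    η * h * s ≤ η * C * Real.exp (-c) * Real.exp (-θ * l) := by
  have hR : 0 ≤ η * C * Real.exp (-c) * Real.exp (-θ * l) := by positivity
  rcases le_total s 0 with hs | hs
  · exact (mul_nonpos_of_nonneg_of_nonpos (by positivity) hs).trans hR
  · have e1 : Real.exp (-q) = Real.exp (-c) * Real.exp (-θ * l) * Real.exp (-s) := by
      rw [hq, ← Real.exp_add, ← Real.exp_add]; ring_nf
    calc η * h * s ≤ η * (C * Real.exp (-q)) * s := by gcongr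
      _ = η * C * Real.exp (-c) * Real.exp (-θ * l) * (s * Real.exp (-s)) := by rw [e1]; ring
      _ ≤ η * C * Real.exp (-c) * Real.exp (-θ * l) * 1 := by
          gcongr; exact mul_exp_neg_le_one s
      _ = _ := mul_one _

theorem abs_sub_exp_neg_le {g p q ε μ : ℝ} (hμ : 0 < μ) (hpq : |p - q| ≤ ε) (hε : ε ≤ 1)
    (hg : |g - Real.exp (-p)| ≤ Real.exp (-(1 + μ) * p)) :
    |g - Real.exp (-q)| ≤
      2 * ε * Real.exp (-q) + Real.exp (1 + μ) * Real.exp (-(1 + μ) * q) := by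
  have h1 : |Real.exp (-p) - Real.exp (-q)| ≤ 2 * ε * Real.exp (-q) := by
    have : Real.exp (-p) - Real.exp (-q) = Real.exp (-q) * (Real.exp (q - p) - 1) := by
      rw [mul_sub, ← Real.exp_add]; ring_nf
    rw [this, abs_mul, Real.abs_exp, mul_comm]
    gcongr
    have h := Real.abs_exp_sub_one_le (x := q - p) (by rw [abs_sub_comm]; linarith)
    rw [abs_sub_comm q p] at h
    linarith
  have h2 : Real.exp (-(1 + μ) * p) ≤ Real.exp (1 + μ) * Real.exp (-(1 + μ) * q) := by
    rw [← Real.exp_add]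
    gcongr
    nlinarith [(abs_le.1 hpq).1]
  calc |g - Real.exp (-q)| ≤ |g - Real.exp (-p)| + |Real.exp (-p) - Real.exp (-q)| :=
        abs_sub_le _ _ _
    _ ≤ _ := by linarith

/-- The loss derivative at `p` controls `e^{-q}` for `q` near `p`; this turns an error of the form
`e^{-q} δ` into the summable `δ²`. -/
theorem exp_neg_le_six_mul {g p q μ : ℝ} (hpq : |p - q| ≤ 1)
    (hg : |g - Real.exp (-p)| ≤ Real.exp (-(1 + μ) * p))
    (hp : Real.exp (-μ * p) ≤ 1 / 2) : Real.exp (-q) ≤ 6 * g := by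
  have e3 : Real.exp (-(1 + μ) * p) = Real.exp (-μ * p) * Real.exp (-p) := by
    rw [← Real.exp_add]; ring_nf
  have h1 : Real.exp (-q) ≤ Real.exp 1 * Real.exp (-p) := by
    rw [← Real.exp_add]; gcongr; linarith [(abs_le.1 hpq).2]
  have h2 := (abs_le.1 hg).1
  have h3 := Real.exp_one_lt_d9
  rw [e3] at h2
  nlinarith [Real.exp_pos (-p)]

/-! ### The loss and its descent over a cycle -/

theorem LossShape.smoothness_nonneg {loss : ℝ → ℝ} {β : ℝ} (h : LossShape loss β) : 0 ≤ β := by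
  simpa using (abs_nonneg _).trans (h.smooth 1 0)

theorem LossShape.continuous_deriv {loss : ℝ → ℝ} {β : ℝ} (h : LossShape loss β) :
    Continuous (deriv loss) := by
  have hβ : 0 ≤ β := h.smoothness_nonneg
  refine (LipschitzWith.of_dist_le_mul (K := ⟨β, hβ⟩) fun u v => ?_).continuous
  rw [Real.dist_eq, Real.dist_eq]
  exact h.smooth u v

/-- The derivative of the loss can tend to `0` only at `+∞`: near `-∞` it is kept away from `0` by the
condition on the upper limit, and on a compact interval by continuity. -/
theorem LossShape.exists_pos_le_neg_deriv {loss : ℝ → ℝ} {β : ℝ} (h : LossShape loss β) (A : ℝ) :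
    ∃ c, 0 < c ∧ ∀ u ≤ A, c ≤ -deriv loss u := by
  obtain ⟨b, hb1, hb2⟩ := EReal.lt_iff_exists_real_btwn.1 h.limsup_neg
  have hb0 : b < 0 := by exact_mod_cast hb2
  obtain ⟨B, hB⟩ := eventually_atBot.1 (eventually_lt_of_limsup_lt hb1)
  rcases le_or_gt A B with hAB | hAB
  · refine ⟨-b, by linarith, fun u hu => ?_⟩
    have : deriv loss u < b := by exact_mod_cast hB u (hu.trans hAB)
    linarith
  · obtain ⟨v, -, hv⟩ := isCompact_Icc.exists_isMaxOn (Set.nonempty_Icc.2 hAB.le)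
      h.continuous_deriv.continuousOn
    refine ⟨min (-b) (-deriv loss v), lt_min (by linarith) (by linarith [h.deriv_neg v]),
      fun u hu => ?_⟩
    rcases le_total u B with huB | huB
    · have : deriv loss u < b := by exact_mod_cast hB u huB
      exact (min_le_left _ _).trans (by linarith)
    · have := hv (show u ∈ Set.Icc B A from ⟨huB, hu⟩)
      exact (min_le_right _ _).trans (neg_le_neg this)

/-- The quadratic upper bound for a `β`-smooth function, with constant `β` instead of the optimal
`β / 2`; it follows from the mean value theorem. -/
theorem LossShape.le_add_deriv_mul {loss : ℝ → ℝ} {β : ℝ} (h : LossShape loss β) (a b : ℝ) :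
    loss (a + b) ≤ loss a + deriv loss a * b + β * b ^ 2 := by
  have hβ : 0 ≤ β := h.smoothness_nonneg
  obtain ⟨c, hc, heq⟩ : ∃ c, |c - a| ≤ |b| ∧ loss (a + b) - loss a = deriv loss c * b := by
    rcases lt_trichotomy b 0 with hb | hb | hb
    · obtain ⟨c, hc, hd⟩ := exists_deriv_eq_slope loss (show a + b < a by linarith)
        h.differentiable.continuous.continuousOn h.differentiable.differentiableOn
      refine ⟨c, ?_, ?_⟩
      · rw [abs_of_neg hb, abs_le]; constructor <;> linarith [hc.1, hc.2]
      · rw [hd]; field_simp [hb.ne]; ring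
    · exact ⟨a, by simp, by simp [hb]⟩
    · obtain ⟨c, hc, hd⟩ := exists_deriv_eq_slope loss (show a < a + b by linarith)
        h.differentiable.continuous.continuousOn h.differentiable.differentiableOn
      refine ⟨c, ?_, ?_⟩
      · rw [abs_of_pos hb, abs_le]; constructor <;> linarith [hc.1, hc.2]
      · rw [hd]; field_simp [hb.ne']; ring
  have h1 : (deriv loss c - deriv loss a) * b ≤ β * b ^ 2 := by
    calc (deriv loss c - deriv loss a) * b ≤ |deriv loss c - deriv loss a| * |b| := by
          rw [← abs_mul]; exact le_abs_self _
      _ ≤ (β * |b|) * |b| := by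
          gcongr
          exact (h.smooth c a).trans (by gcongr)
      _ = β * b ^ 2 := by rw [mul_assoc, ← sq, sq_abs]
  linarith

section Cycle

variable {V ι κ : Type*} [NormedAddCommGroup V] [InnerProductSpace ℝ V] [Fintype ι] [Fintype κ]
  [DecidableEq κ]

theorem sum_abs_inner_mul_abs_inner_le {z : ι → V} {σ : ℝ}
    (hz : ∀ v, ∑ i, inner ℝ (z i) v ^ 2 ≤ σ ^ 2 * ‖v‖ ^ 2) (s : Finset ι) (v w : V) :
    ∑ i ∈ s, |inner ℝ (z i) v| * |inner ℝ (z i) w| ≤ σ ^ 2 * ‖v‖ * ‖w‖ := by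
  have hs : ∀ v, ∑ i ∈ s, |inner ℝ (z i) v| ^ 2 ≤ (σ * ‖v‖) ^ 2 := fun v => by
    simp only [sq_abs, mul_pow]
    exact (Finset.sum_le_univ_sum_of_nonneg fun i => sq_nonneg _).trans (hz v)
  have h := Finset.sum_mul_sq_le_sq_mul_sq s (fun i => |inner ℝ (z i) v|)
    (fun i => |inner ℝ (z i) w|)
  have h2 : (∑ i ∈ s, |inner ℝ (z i) v| * |inner ℝ (z i) w|) ^ 2 ≤ (σ ^ 2 * ‖v‖ * ‖w‖) ^ 2 := by
    calc _ ≤ (σ * ‖v‖) ^ 2 * (σ * ‖w‖) ^ 2 := by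
          refine h.trans (mul_le_mul (hs v) (hs w) ?_ ?_)
          · exact Finset.sum_nonneg fun i _ => sq_nonneg _
          · positivity
      _ = _ := by ring
  exact abs_le_of_sq_le_sq' h2 (by positivity) |>.2

theorem norm_le_of_sum_inner_sq_le {z : ι → V} {σ : ℝ} (hσ : 0 ≤ σ)
    (hz : ∀ v, ∑ i, inner ℝ (z i) v ^ 2 ≤ σ ^ 2 * ‖v‖ ^ 2) (i : ι) : ‖z i‖ ≤ σ := by
  have h1 : (‖z i‖ ^ 2) ^ 2 ≤ σ ^ 2 * ‖z i‖ ^ 2 := by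
    rw [← real_inner_self_eq_norm_sq (z i)]
    refine le_trans ?_ ((hz (z i)).trans_eq (by rw [real_inner_self_eq_norm_sq]))
    exact Finset.single_le_sum (f := fun j => inner ℝ (z j) (z i) ^ 2)
      (fun j _ => sq_nonneg _) (Finset.mem_univ i)
  rcases (norm_nonneg (z i)).eq_or_lt with h0 | h0
  · linarith
  · refine abs_le_of_sq_le_sq' ?_ hσ |>.2
    have : 0 < ‖z i‖ ^ 2 := by positivity
    nlinarith

/-- One full cycle decreases the joint loss by a multiple of the squared displacement. Here
`z i = y_i x_i`, `τ i` is the task of `i`, `P m k` is the `k`-th iterate of task `m` in the cycle,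
and `c i` is the total weight given to `z i` during the cycle. Since `c` is entrywise nonnegative,
the margin gives `φ ∑ c ≤ ‖∑ c i • z i‖`, so that all iterates of the cycle stay within a multiple
of `‖u' - u‖` from its start; the cycle is then close to `K` full gradient steps at `u`. -/
theorem LossShape.cycle_descent {loss : ℝ → ℝ} {β : ℝ} (h : LossShape loss β)
    {z : ι → V} {τ : ι → κ} {σ φ η : ℝ} {K : ℕ} (hσ : 0 ≤ σ) (hφ : 0 < φ) (hη : 0 < η)
    (hK : 1 ≤ K) (hz : ∀ v, ∑ i, inner ℝ (z i) v ^ 2 ≤ σ ^ 2 * ‖v‖ ^ 2)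
    (hmargin : ∀ c : ι → ℝ, (∀ i, 0 ≤ c i) → φ * ∑ i, c i ≤ ‖∑ i, c i • z i‖)
    (hstep : Fintype.card κ * β * σ ^ 3 / φ + β * σ ^ 2 ≤ 1 / (2 * (K * η)))
    {u u' : V} {P : κ → ℕ → V} {c : ι → ℝ}
    (hc : ∀ i, c i = ∑ k ∈ Finset.range K, -deriv loss (inner ℝ (z i) (P (τ i) k)))
    (hu' : u' = u + η • ∑ i, c i • z i)
    (hP : ∀ m, ∀ k < K, ‖P m k - u‖ ≤ η * σ * ∑ i, c i) :
    ∑ i, loss (inner ℝ (z i) u') ≤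
      ∑ i, loss (inner ℝ (z i) u) - 1 / (2 * (K * η)) * ‖u' - u‖ ^ 2 := by
  have hβ : 0 ≤ β := h.smoothness_nonneg
  have hKpos : (0 : ℝ) < K := by exact_mod_cast hK
  set D := u' - u with hD
  have hDeq : D = η • ∑ i, c i • z i := by rw [hD, hu']; abel
  have hu'D : u' = u + D := by rw [hD]; abel
  have hc0 : ∀ i, 0 ≤ c i := fun i => by
    rw [hc]; exact Finset.sum_nonneg fun k _ => by linarith [h.deriv_neg (inner ℝ (z i) (P (τ i) k))]
  have hH0 : 0 ≤ ∑ i, c i := Finset.sum_nonneg fun i _ => hc0 i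
  have hH : η * φ * ∑ i, c i ≤ ‖D‖ := by
    rw [hDeq, norm_smul, Real.norm_of_nonneg hη.le, mul_assoc]
    exact mul_le_mul_of_nonneg_left (hmargin c hc0) hη.le
  have hPD : ∀ m, ∀ k < K, ‖P m k - u‖ ≤ σ * ‖D‖ / φ := fun m k hk => by
    refine (hP m k hk).trans ?_
    rw [le_div_iff₀ hφ]
    nlinarith
  -- The second-order expansion of the joint loss at `u`.
  have h1 : ∑ i, loss (inner ℝ (z i) u') ≤ ∑ i, loss (inner ℝ (z i) u) +
      ∑ i, deriv loss (inner ℝ (z i) u) * inner ℝ (z i) D + β * (σ ^ 2 * ‖D‖ ^ 2) := by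
    calc _ ≤ ∑ i, (loss (inner ℝ (z i) u) + deriv loss (inner ℝ (z i) u) * inner ℝ (z i) D +
          β * inner ℝ (z i) D ^ 2) := by
          refine Finset.sum_le_sum fun i _ => ?_
          rw [hu'D, inner_add_right]
          exact h.le_add_deriv_mul _ _
      _ ≤ _ := by
          rw [Finset.sum_add_distrib, Finset.sum_add_distrib, ← Finset.mul_sum]
          gcongr
          exact hz D
  have h2 : ∑ i, c i * inner ℝ (z i) D = 1 / η * ‖D‖ ^ 2 := by
    have : inner ℝ D D = η * ∑ i, c i * inner ℝ (z i) D := by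
      conv_lhs => rw [hDeq, real_inner_smul_left, sum_inner, ← hDeq]
      simp only [real_inner_smul_left]
    rw [← real_inner_self_eq_norm_sq, this]
    field_simp
  -- The weights `c` differ from `K` times the weights of the full gradient at `u` by a multiple
  -- of the displacement; the sum over the data is split into the tasks.
  have h3 : ∑ i, (c i + K * deriv loss (inner ℝ (z i) u)) * inner ℝ (z i) D ≤
      K * (Fintype.card κ * β * σ ^ 3 / φ) * ‖D‖ ^ 2 := by
    calc _ ≤ ∑ i, ∑ k ∈ Finset.range K,
          β * (|inner ℝ (z i) (P (τ i) k - u)| * |inner ℝ (z i) D|) := by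
          refine Finset.sum_le_sum fun i _ => ?_
          have : c i + K * deriv loss (inner ℝ (z i) u) = ∑ k ∈ Finset.range K,
              (deriv loss (inner ℝ (z i) u) - deriv loss (inner ℝ (z i) (P (τ i) k))) := by
            rw [hc, Finset.sum_sub_distrib, Finset.sum_neg_distrib]; simp; ring
          rw [this, Finset.sum_mul]
          refine Finset.sum_le_sum fun k _ => ?_
          refine (le_abs_self _).trans ?_
          rw [abs_mul, ← mul_assoc, inner_sub_right (z i) (P (τ i) k) u,
            abs_sub_comm (inner ℝ (z i) (P (τ i) k))]
          gcongr
          exact h.smooth _ _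
      _ = ∑ k ∈ Finset.range K, ∑ m, ∑ i with τ i = m,
          β * (|inner ℝ (z i) (P m k - u)| * |inner ℝ (z i) D|) := by
          rw [Finset.sum_comm]
          refine Finset.sum_congr rfl fun k _ => ?_
          rw [← Finset.sum_fiberwise (g := τ)]
          refine Finset.sum_congr rfl fun m _ => Finset.sum_congr rfl fun i hi => ?_
          rw [(Finset.mem_filter.1 hi).2]
      _ ≤ ∑ k ∈ Finset.range K, ∑ m : κ, β * (σ ^ 2 * (σ * ‖D‖ / φ) * ‖D‖) := by
          refine Finset.sum_le_sum fun k hk => Finset.sum_le_sum fun m _ => ?_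
          rw [← Finset.mul_sum]
          gcongr
          refine (sum_abs_inner_mul_abs_inner_le hz _ _ _).trans ?_
          gcongr
          exact hPD m k (Finset.mem_range.1 hk)
      _ = _ := by simp; ring
  have h4 : ∑ i, deriv loss (inner ℝ (z i) u) * inner ℝ (z i) D ≤
      -(1 / (K * η)) * ‖D‖ ^ 2 + (Fintype.card κ * β * σ ^ 3 / φ) * ‖D‖ ^ 2 := by
    have e : ∑ i, (c i + K * deriv loss (inner ℝ (z i) u)) * inner ℝ (z i) D =
        1 / η * ‖D‖ ^ 2 + K * ∑ i, deriv loss (inner ℝ (z i) u) * inner ℝ (z i) D := by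
      rw [← h2, Finset.mul_sum, ← Finset.sum_add_distrib]
      exact Finset.sum_congr rfl fun i _ => by ring
    rw [e] at h3
    have : ∑ i, deriv loss (inner ℝ (z i) u) * inner ℝ (z i) D =
        (K * ∑ i, deriv loss (inner ℝ (z i) u) * inner ℝ (z i) D) / K := by
      field_simp
    rw [this, div_le_iff₀ hKpos]
    have e2 : (-(1 / (K * η)) * ‖D‖ ^ 2 + (Fintype.card κ * β * σ ^ 3 / φ) * ‖D‖ ^ 2) * K =
      -(1 / η * ‖D‖ ^ 2) + K * (Fintype.card κ * β * σ ^ 3 / φ) * ‖D‖ ^ 2 := by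
      field_simp
    rw [e2]
    linarith
  have h5 := mul_le_mul_of_nonneg_right hstep (sq_nonneg ‖D‖)
  have h6 : 1 / (K * η) * ‖D‖ ^ 2 = 2 * (1 / (2 * (K * η)) * ‖D‖ ^ 2) := by
    field_simp
  nlinarith

theorem summable_sq_norm_of_descent {F : ℕ → ℝ} {D : ℕ → ℝ} {c : ℝ} (hc : 0 < c)
    (hF : ∀ n, 0 ≤ F n) (h : ∀ n, F (n + 1) ≤ F n - c * D n ^ 2) :
    Summable fun n => D n ^ 2 := by
  have key : ∀ n, c * ∑ j ∈ Finset.range n, D j ^ 2 ≤ F 0 - F n := by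
    intro n
    induction n with
    | zero => simp
    | succ n ih => rw [Finset.sum_range_succ, mul_add]; linarith [h n]
  refine summable_of_sum_range_le (c := F 0 / c) (fun n => sq_nonneg _) fun n => ?_
  rw [le_div_iff₀ hc]
  linarith [key n, hF n]

theorem LossShape.tendsto_atTop_of_deriv_tendsto_zero {loss : ℝ → ℝ} {β : ℝ}
    (h : LossShape loss β) {p : ℕ → ℝ} (hp : Tendsto (fun n => -deriv loss (p n)) atTop (𝓝 0)) :
    Tendsto p atTop atTop := by
  refine tendsto_atTop.2 fun A => ?_
  obtain ⟨c, hc, hA⟩ := h.exists_pos_le_neg_deriv A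
  filter_upwards [hp.eventually_lt_const hc] with n hn
  by_contra hlt
  linarith [hA (p n) (by linarith)]

end Cycle

/-! ### Logarithmic growth along the max-margin direction -/

/-- The two-sided tail in symmetric form, with the smaller of the two exponents. -/
theorem TightExponentialTail.exists_abs_sub_le {loss : ℝ → ℝ} (h : TightExponentialTail loss) :
    ∃ μ U : ℝ, 0 < μ ∧ ∀ p, U < p →
      |-deriv loss p - Real.exp (-p)| ≤ Real.exp (-(1 + μ) * p) := by
  obtain ⟨μp, μm, ub, hp, hm, hub, hb⟩ := h
  refine ⟨min μp μm, ub, lt_min hp hm, fun p hup => ?_⟩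
  have hp0 : 0 ≤ p := by linarith
  obtain ⟨h1, h2⟩ := hb p hup
  have e : Real.exp (-(1 + min μp μm) * p) = Real.exp (-min μp μm * p) * Real.exp (-p) := by
    rw [← Real.exp_add]; ring_nf
  have l1 : Real.exp (-μp * p) ≤ Real.exp (-min μp μm * p) := by
    gcongr; exact min_le_left _ _
  have l2 : Real.exp (-μm * p) ≤ Real.exp (-min μp μm * p) := by
    gcongr; exact min_le_right _ _
  rw [e, abs_le]
  constructor <;> nlinarith [Real.exp_pos (-p)]

/-- If `K` points stay within `C₀ δ` of `q → ∞`, and `δ → 0` bounds the sum of the values of `g` there,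
then this sum is `K e^{-q}` up to an error `O(δ² + e^{-(1+μ)q})`. The displacement costs
`O(δ e^{-q})`, and `e^{-q} = O(δ)` because the sum itself is at most `δ`. -/
theorem eventually_abs_sum_sub_mul_exp_neg_le {g : ℝ → ℝ} {μ U : ℝ} (hμ : 0 < μ)
    (hg0 : ∀ u, 0 ≤ g u) (hg : ∀ p, U < p → |g p - Real.exp (-p)| ≤ Real.exp (-(1 + μ) * p))
    {K : ℕ} (hK : 1 ≤ K) {C₀ : ℝ} (hC₀ : 0 ≤ C₀) {q δ : ℕ → ℝ} {p : ℕ → ℕ → ℝ}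
    (hq : Tendsto q atTop atTop) (hδ0 : ∀ n, 0 ≤ δ n) (hδ : Tendsto δ atTop (𝓝 0))
    (hpq : ∀ n, ∀ k < K, |p n k - q n| ≤ C₀ * δ n)
    (hle : ∀ n, ∑ k ∈ Finset.range K, g (p n k) ≤ δ n) :
    ∃ C, 0 ≤ C ∧ ∀ᶠ n in atTop,
      |∑ k ∈ Finset.range K, g (p n k) - K * Real.exp (-q n)| ≤
        C * (δ n ^ 2 + Real.exp (-(1 + μ) * q n)) ∧
      ∑ k ∈ Finset.range K, g (p n k) ≤ C * Real.exp (-q n) := by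
  refine ⟨K * (12 * C₀ + 3 + Real.exp (1 + μ)), by positivity, ?_⟩
  have hδ' : ∀ᶠ n in atTop, C₀ * δ n < 1 :=
    (hδ.const_mul C₀).eventually_lt_const (by simp)
  filter_upwards [hδ', hq.eventually_ge_atTop (U + 2), hq.eventually_ge_atTop 1,
    hq.eventually_ge_atTop (1 / μ + 1)] with n h1 h2 h3 h4
  have hexp : ∀ k < K, Real.exp (-μ * p n k) ≤ 1 / 2 := fun k hk => by
    have hp : 1 / μ ≤ p n k := by linarith [(abs_le.1 (hpq n k hk)).1]
    have hp' : 1 ≤ μ * p n k := by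
      calc (1 : ℝ) = μ * (1 / μ) := by field_simp
        _ ≤ _ := by gcongr
    have : Real.exp (-μ * p n k) ≤ Real.exp (-1) := by gcongr; linarith
    refine this.trans ?_
    rw [Real.exp_neg, inv_le_comm₀ (Real.exp_pos 1) (by norm_num)]
    linarith [Real.add_one_le_exp (1 : ℝ)]
  have htail : ∀ k < K, |g (p n k) - Real.exp (-p n k)| ≤ Real.exp (-(1 + μ) * p n k) :=
    fun k hk => hg _ (by linarith [(abs_le.1 (hpq n k hk)).1])
  have hsix : Real.exp (-q n) ≤ 6 * δ n := by
    refine (exp_neg_le_six_mul ((hpq n 0 hK).trans h1.le) (htail 0 hK) (hexp 0 hK)).trans ?_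
    gcongr
    exact (Finset.single_le_sum (f := fun k => g (p n k)) (fun k _ => hg0 _)
      (Finset.mem_range.2 hK)).trans (hle n)
  have hmu : Real.exp (-(1 + μ) * q n) ≤ Real.exp (-q n) := by
    gcongr; nlinarith
  have hest : ∀ k < K, |g (p n k) - Real.exp (-q n)| ≤
      2 * (C₀ * δ n) * Real.exp (-q n) + Real.exp (1 + μ) * Real.exp (-(1 + μ) * q n) :=
    fun k hk => abs_sub_exp_neg_le hμ (hpq n k hk) h1.le (htail k hk)
  have hE := Real.exp_pos (1 + μ)
  have hE2 := Real.exp_pos (-(1 + μ) * q n)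
  have hE3 := Real.exp_pos (-q n)
  constructor
  · have : ∑ k ∈ Finset.range K, g (p n k) - K * Real.exp (-q n) =
        ∑ k ∈ Finset.range K, (g (p n k) - Real.exp (-q n)) := by
      rw [Finset.sum_sub_distrib]; simp
    rw [this]
    refine (Finset.abs_sum_le_sum_abs _ _).trans ?_
    calc _ ≤ ∑ k ∈ Finset.range K,
          (12 * C₀ + 3 + Real.exp (1 + μ)) * (δ n ^ 2 + Real.exp (-(1 + μ) * q n)) := by
          refine Finset.sum_le_sum fun k hk => (hest k (Finset.mem_range.1 hk)).trans ?_
          have h5 : 2 * (C₀ * δ n) * Real.exp (-q n) ≤ 2 * (C₀ * δ n) * (6 * δ n) := by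
            have := hδ0 n
            gcongr
          have h6 : 0 ≤ Real.exp (1 + μ) * δ n ^ 2 := by positivity
          have h7 : 0 ≤ C₀ * Real.exp (-(1 + μ) * q n) := by positivity
          nlinarith [sq_nonneg (δ n)]
      _ = _ := by simp; ring
  · calc _ ≤ ∑ k ∈ Finset.range K, (12 * C₀ + 3 + Real.exp (1 + μ)) * Real.exp (-q n) := by
          refine Finset.sum_le_sum fun k hk => ?_
          have h5 := (abs_le.1 (hest k (Finset.mem_range.1 hk))).2
          have h6 : 2 * (C₀ * δ n) * Real.exp (-q n) ≤ 2 * 1 * Real.exp (-q n) := by gcongr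
          have h7 : 0 ≤ C₀ * Real.exp (-q n) := by positivity
          nlinarith
      _ = _ := by simp; ring

/-- `log (n + 2) - log (n + 1)` lies between `0` and `1 / (n + 1)`, and differs from the latter by at
most `1 / (n + 1)²`; the powers of `n + 1` are written as exponentials of the logarithm. -/
theorem log_succ_sub_log_bounds (n : ℕ) :
    0 ≤ Real.log ((n : ℝ) + 1 + 1) - Real.log (n + 1) ∧
    Real.log ((n : ℝ) + 1 + 1) - Real.log (n + 1) ≤ Real.exp (-Real.log (n + 1)) ∧
    Real.exp (-Real.log (n + 1)) - (Real.log ((n : ℝ) + 1 + 1) - Real.log (n + 1)) ≤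
      Real.exp (-2 * Real.log (n + 1)) := by
  have hn : (0 : ℝ) < n + 1 := by positivity
  have hn2 : (0 : ℝ) < (n : ℝ) + 1 + 1 := by positivity
  have e1 : Real.exp (-Real.log ((n : ℝ) + 1)) = 1 / (n + 1) := by
    rw [Real.exp_neg, Real.exp_log hn, one_div]
  have e2 : Real.exp (-2 * Real.log ((n : ℝ) + 1)) = 1 / (n + 1) ^ 2 := by
    have : -2 * Real.log ((n : ℝ) + 1) = -Real.log (n + 1) + -Real.log (n + 1) := by ring
    rw [this, Real.exp_add, e1]; field_simp
  rw [e1, e2, ← Real.log_div hn2.ne' hn.ne']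
  have hd : 0 < ((n : ℝ) + 1 + 1) / (n + 1) := by positivity
  have lo := Real.one_sub_inv_le_log_of_pos hd
  have up := Real.log_le_sub_one_of_pos hd
  have f1 : 1 - (((n : ℝ) + 1 + 1) / (n + 1))⁻¹ = 1 / (n + 1 + 1) := by
    rw [inv_div]; field_simp; ring
  have f2 : ((n : ℝ) + 1 + 1) / (n + 1) - 1 = 1 / (n + 1) := by field_simp; ring
  rw [f1] at lo
  rw [f2] at up
  refine ⟨le_trans (by positivity) lo, up, ?_⟩
  have : 1 / ((n : ℝ) + 1) - 1 / (n + 1 + 1) ≤ 1 / (n + 1) ^ 2 := by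
    rw [div_sub_div _ _ hn.ne' hn2.ne', div_le_div_iff₀ (by positivity) (by positivity)]
    nlinarith
  linarith

/-- The logarithmic growth of the iterates in the direction `w`. The vector `v` makes
`log (n + 1) • w + v` a solution of the limiting recursion up to summable errors: with
`α i = η K exp (-⟪z i, v⟫)`, one step of it adds
`∑ i, α i / (n + 1) • z i = w / (n + 1)`. The squared norm of the residual then satisfies a Grönwall
inequality. -/
theorem exists_norm_sub_log_smul_le {V ι : Type*} [NormedAddCommGroup V] [InnerProductSpace ℝ V]
    [Fintype ι] {z : ι → V} {η K μ B₀ : ℝ} (hη : 0 < η) (hK : 0 < K) (hμ : 0 < μ)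
    {u : ℕ → V} {h : ℕ → ι → ℝ} {δ : ℕ → ℝ} (hδ : Summable fun n => δ n ^ 2)
    (hu : ∀ n, u (n + 1) = u n + η • ∑ i, h n i • z i)
    (hd : ∀ n, ‖u (n + 1) - u n‖ ≤ B₀ * δ n) (hh0 : ∀ n i, 0 ≤ h n i)
    (hq : ∀ i, Tendsto (fun n => inner ℝ (z i) (u n)) atTop atTop)
    (hest : ∀ i, ∃ C, 0 ≤ C ∧ ∀ᶠ n in atTop,
      |h n i - K * Real.exp (-inner ℝ (z i) (u n))| ≤
        C * (δ n ^ 2 + Real.exp (-(1 + μ) * inner ℝ (z i) (u n))) ∧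
      h n i ≤ C * Real.exp (-inner ℝ (z i) (u n)))
    {α : ι → ℝ} {w v : V} (hw : w = ∑ i, α i • z i)
    (hα : ∀ i, (α i = η * K * Real.exp (-inner ℝ (z i) v) ∧ inner ℝ (z i) w = 1) ∨
      (α i = 0 ∧ 1 < inner ℝ (z i) w)) :
    ∃ B, ∀ n : ℕ, ‖u n - Real.log (n + 1) • w‖ ≤ B := by
  set r : ℕ → V := fun n => u n - Real.log (n + 1) • w - v with hr
  have hqr : ∀ n i, inner ℝ (z i) (u n) =
      inner ℝ (z i) (r n) + inner ℝ (z i) w * Real.log (n + 1) + inner ℝ (z i) v := fun n i => by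
    simp only [hr, inner_sub_right, inner_smul_right]; ring
  -- The summands of `⟪r (n + 1) - r n, r n⟫` are bounded above by summable terms, linear in `‖r n‖`.
  have drift : ∀ i, ∃ C₁ C₂ p : ℝ, 0 ≤ C₁ ∧ 0 ≤ C₂ ∧ 1 < p ∧ ∀ᶠ n : ℕ in atTop,
      (η * h n i - α i * Real.exp (-Real.log (n + 1))) * inner ℝ (z i) (r n) ≤
        C₁ * Real.exp (-p * Real.log (n + 1)) + C₂ * δ n ^ 2 * ‖r n‖ := by
    intro i
    obtain ⟨C, hC, hev⟩ := hest i
    rcases hα i with ⟨hαi, hwi⟩ | ⟨hαi, hwi⟩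
    · refine ⟨η * C * Real.exp (-(1 + μ) * inner ℝ (z i) v) * Real.exp (1 + μ),
        η * C * ‖z i‖, 1 + μ, by positivity, by positivity, by linarith, ?_⟩
      have hsm : Tendsto (fun n => C * Real.exp (-μ * inner ℝ (z i) (u n))) atTop (𝓝 0) := by
        have h1 : Tendsto (fun n => -μ * inner ℝ (z i) (u n)) atTop atBot :=
          (hq i).const_mul_atTop_of_neg (by linarith)
        simpa using (Real.tendsto_exp_atBot.comp h1).const_mul C
      filter_upwards [hev, hsm.eventually_le_const (show (0 : ℝ) < K / 2 by positivity)]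
        with n h1 h2
      have h3 := support_drift_le hη hK hC hμ
        (by rw [hqr n i, hwi, one_mul]) h1.1 h2
      rw [← hαi] at h3
      refine h3.trans ?_
      have h4 : η * C * δ n ^ 2 * |inner ℝ (z i) (r n)| ≤
          η * C * δ n ^ 2 * (‖z i‖ * ‖r n‖) := by
        gcongr
        exact abs_real_inner_le_norm _ _
      linarith
    · refine ⟨η * C * Real.exp (-inner ℝ (z i) v), 0, inner ℝ (z i) w, by positivity,
        le_rfl, hwi, ?_⟩
      filter_upwards [hev] with n h1
      have h3 := nonsupport_drift_le hη hC (hqr n i) (hh0 n i) h1.2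
      rw [hαi]
      linarith
  choose C₁ C₂ p hC₁ hC₂ hp hdrift using drift
  set b : ℕ → ℝ := fun n => (∑ i, C₂ i) * δ n ^ 2 + ‖w‖ * Real.exp (-2 * Real.log (n + 1)) with hb
  set a : ℕ → ℝ := fun n => 2 * ∑ i, C₁ i * Real.exp (-p i * Real.log (n + 1)) +
    2 * B₀ ^ 2 * δ n ^ 2 + 2 * ‖w‖ ^ 2 * Real.exp (-2 * Real.log (n + 1)) + b n with ha
  have hb0 : ∀ n, 0 ≤ b n := fun n => by
    have : 0 ≤ ∑ i, C₂ i := Finset.sum_nonneg fun i _ => hC₂ i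
    simp only [hb]; positivity
  have ha0 : ∀ n, 0 ≤ a n := fun n => by
    have : 0 ≤ ∑ i, C₁ i * Real.exp (-p i * Real.log (n + 1)) :=
      Finset.sum_nonneg fun i _ => mul_nonneg (hC₁ i) (Real.exp_pos _).le
    have := hb0 n
    simp only [ha]; positivity
  have hsq : Summable fun n : ℕ => Real.exp (-2 * Real.log (n + 1)) :=
    summable_exp_neg_mul_log (by norm_num)
  have hsb : Summable b := (hδ.mul_left _).add (hsq.mul_left _)
  have hsa : Summable a := by
    refine (((Summable.mul_left _ ?_).add (hδ.mul_left _)).add (hsq.mul_left _)).add hsb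
    exact summable_sum fun i _ => (summable_exp_neg_mul_log (hp i)).mul_left _
  have hrec : ∀ᶠ n in atTop, ‖r (n + 1)‖ ^ 2 ≤ (1 + b n) * ‖r n‖ ^ 2 + a n := by
    filter_upwards [eventually_all.2 hdrift] with n hn
    obtain ⟨l0, l1, l2⟩ := log_succ_sub_log_bounds n
    set E := Real.exp (-Real.log ((n : ℝ) + 1)) with hE
    set lam := Real.log ((n : ℝ) + 1 + 1) - Real.log (n + 1) with hlam
    have hstep : r (n + 1) = r n + (u (n + 1) - u n - lam • w) := by
      simp only [hr, hlam, sub_smul]; push_cast; abel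
    have hin : inner ℝ (u (n + 1) - u n - lam • w) (r n) =
        ∑ i, (η * h n i - α i * E) * inner ℝ (z i) (r n) + (E - lam) * inner ℝ w (r n) := by
      have e1 : inner ℝ (u (n + 1) - u n) (r n) = ∑ i, η * h n i * inner ℝ (z i) (r n) := by
        rw [hu n, add_sub_cancel_left, real_inner_smul_left, sum_inner, Finset.mul_sum]
        exact Finset.sum_congr rfl fun i _ => by rw [real_inner_smul_left]; ring
      have e2 : inner ℝ w (r n) = ∑ i, α i * inner ℝ (z i) (r n) := by
        conv_lhs => rw [hw, sum_inner]
        exact Finset.sum_congr rfl fun i _ => by rw [real_inner_smul_left]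
      rw [inner_sub_left, real_inner_smul_left, e1, sub_mul E, e2, Finset.mul_sum, Finset.mul_sum,
        ← add_sub_assoc, ← Finset.sum_add_distrib]
      congr 1
      exact Finset.sum_congr rfl fun i _ => by ring
    have hsum : ∑ i, (η * h n i - α i * E) * inner ℝ (z i) (r n) ≤
        ∑ i, C₁ i * Real.exp (-p i * Real.log (n + 1)) + (∑ i, C₂ i) * δ n ^ 2 * ‖r n‖ := by
      rw [Finset.sum_mul, Finset.sum_mul, ← Finset.sum_add_distrib]
      exact Finset.sum_le_sum fun i _ => hn i
    have hlast : (E - lam) * inner ℝ w (r n) ≤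
        ‖w‖ * Real.exp (-2 * Real.log (n + 1)) * ‖r n‖ := by
      calc (E - lam) * inner ℝ w (r n) ≤
            Real.exp (-2 * Real.log (n + 1)) * (‖w‖ * ‖r n‖) := by
            refine mul_le_mul_of_nonneg_left (real_inner_le_norm _ _) (by linarith) |>.trans ?_
            gcongr
        _ = _ := by ring
    have hE2 : E ^ 2 = Real.exp (-2 * Real.log (n + 1)) := by
      rw [hE, ← Real.exp_nat_mul]; push_cast; ring_nf
    have hnorm : ‖u (n + 1) - u n - lam • w‖ ^ 2 ≤
        2 * B₀ ^ 2 * δ n ^ 2 + 2 * ‖w‖ ^ 2 * Real.exp (-2 * Real.log (n + 1)) := by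
      have h1 : ‖u (n + 1) - u n - lam • w‖ ≤ B₀ * δ n + E * ‖w‖ := by
        refine (norm_sub_le _ _).trans (add_le_add (hd n) ?_)
        rw [norm_smul, Real.norm_of_nonneg l0]
        gcongr
      have h2 := pow_le_pow_left₀ (norm_nonneg _) h1 2
      rw [← hE2]
      nlinarith [sq_nonneg (B₀ * δ n - E * ‖w‖)]
    rw [hstep, norm_add_sq_real, real_inner_comm, hin]
    have hbr : 2 * (b n * ‖r n‖) ≤ b n * (1 + ‖r n‖ ^ 2) := by
      nlinarith [mul_nonneg (hb0 n) (sq_nonneg (‖r n‖ - 1))]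
    have hbn : b n * ‖r n‖ = (∑ i, C₂ i) * δ n ^ 2 * ‖r n‖ +
        ‖w‖ * Real.exp (-2 * Real.log (n + 1)) * ‖r n‖ := by
      simp only [hb]; ring
    have han : a n = 2 * ∑ i, C₁ i * Real.exp (-p i * Real.log (n + 1)) +
      2 * B₀ ^ 2 * δ n ^ 2 + 2 * ‖w‖ ^ 2 * Real.exp (-2 * Real.log (n + 1)) + b n := rfl
    rw [han]
    linarith
  obtain ⟨B, hB⟩ := exists_bound_of_le_one_add_mul_add (V := fun n => ‖r n‖ ^ 2)
    (fun n => sq_nonneg _) ha0 hb0 hsa hsb hrec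
  refine ⟨B + 1 + ‖v‖, fun n => ?_⟩
  have h1 : ‖r n‖ ≤ B + 1 := by nlinarith [hB n, sq_nonneg (‖r n‖ - 1)]
  calc ‖u n - Real.log (n + 1) • w‖ = ‖r n + v‖ := by simp [hr]
    _ ≤ _ := (norm_add_le _ _).trans (by linarith)

/-! ### Unrolling the iteration over a cycle -/

section Unroll

variable {V : Type*} [NormedAddCommGroup V]

theorem stage_eq_start_add {W : ℕ → ℕ → V} {G : ℕ → ℕ → V}
    (hstep : ∀ t k, W t (k + 1) = W t k + G t k) (t k : ℕ) :
    W t k = W t 0 + ∑ j ∈ Finset.range k, G t j := by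
  induction k with
  | zero => simp
  | succ k ih => rw [hstep, ih, Finset.sum_range_succ, add_assoc]

theorem start_eq_start_add {W : ℕ → ℕ → V} {G : ℕ → ℕ → V} {K : ℕ}
    (hstep : ∀ t k, W t (k + 1) = W t k + G t k) (hnext : ∀ t, W (t + 1) 0 = W t K) (s m : ℕ) :
    W (s + m) 0 = W s 0 + ∑ j ∈ Finset.range m, ∑ k ∈ Finset.range K, G (s + j) k := by
  induction m with
  | zero => simp
  | succ m ih =>
    rw [← add_assoc, hnext, stage_eq_start_add hstep, ih, Finset.sum_range_succ, add_assoc]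

/-- Every iterate of the `M` stages after stage `s` is within the sum of all step lengths of these stages
from their start. -/
theorem norm_stage_sub_start_le {W : ℕ → ℕ → V} {G : ℕ → ℕ → V} {a : ℕ → ℕ → ℝ} {K M : ℕ}
    (hstep : ∀ t k, W t (k + 1) = W t k + G t k) (hnext : ∀ t, W (t + 1) 0 = W t K)
    (hG : ∀ t k, ‖G t k‖ ≤ a t k) {s m k : ℕ} (hm : m < M) (hk : k ≤ K) :
    ‖W (s + m) k - W s 0‖ ≤ ∑ j ∈ Finset.range M, ∑ k ∈ Finset.range K, a (s + j) k := by
  have ha : ∀ t k, 0 ≤ a t k := fun t k => (norm_nonneg _).trans (hG t k)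
  rw [stage_eq_start_add hstep, start_eq_start_add hstep hnext, add_assoc, add_sub_cancel_left]
  calc _ ≤ ∑ j ∈ Finset.range m, ∑ k ∈ Finset.range K, a (s + j) k +
        ∑ k ∈ Finset.range k, a (s + m) k := by
        refine (norm_add_le _ _).trans (add_le_add ?_ ?_)
        · exact norm_sum_le_of_le _ fun j _ => norm_sum_le_of_le _ fun k _ => hG _ _
        · exact norm_sum_le_of_le _ fun k _ => hG _ _
    _ ≤ ∑ j ∈ Finset.range (m + 1), ∑ k ∈ Finset.range K, a (s + j) k := by
        rw [Finset.sum_range_succ]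
        exact add_le_add_right (Finset.sum_le_sum_of_subset_of_nonneg (Finset.range_mono hk)
          fun k _ _ => ha _ _) _
    _ ≤ _ := Finset.sum_le_sum_of_subset_of_nonneg (Finset.range_mono hm) fun j _ _ =>
        Finset.sum_nonneg fun k _ => ha _ _

end Unroll

/-- The sum over the stages of a cycle, its steps and the data of the current task, rearranged as a sum
over the data. -/
theorem sum_cycle_eq_sum_data {A ι : Type*} [AddCommMonoid A] [Fintype ι] {M K : ℕ} [NeZero M]
    (τ : ι → Fin M) (n : ℕ) (f : ℕ → ℕ → ι → A) :
    ∑ j ∈ Finset.range M, ∑ k ∈ Finset.range K, ∑ i with τ i = cyclicTask M (n * M + j),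
        f (n * M + j) k i = ∑ i, ∑ k ∈ Finset.range K, f (n * M + τ i) k i := by
  rw [Finset.sum_range fun j => ∑ k ∈ Finset.range K, ∑ i with τ i = cyclicTask M (n * M + j),
    f (n * M + j) k i, ← Finset.sum_fiberwise (g := τ)]
  refine Finset.sum_congr rfl fun m _ => ?_
  have hm : cyclicTask M (n * M + m) = m := by
    apply Fin.ext
    change (n * M + m) % M = m
    rw [Nat.mul_comm, Nat.mul_add_mod, Nat.mod_eq_of_lt m.2]
  rw [Finset.sum_comm, hm]
  refine Finset.sum_congr rfl fun i hi => Finset.sum_congr rfl fun k _ => ?_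
  rw [(Finset.mem_filter.1 hi).2]

theorem gradient_trainLoss {d N : ℕ} {loss : ℝ → ℝ} (hl : Differentiable ℝ loss)
    (x : Fin N → Vec d) (y : Fin N → ℝ) (J : Finset (Fin N)) (w : Vec d) :
    gradient (trainLoss loss x y J) w =
      ∑ i ∈ J, deriv loss (inner ℝ (y i • x i) w) • (y i • x i) := by
  apply HasGradientAt.gradient
  rw [hasGradientAt_iff_hasFDerivAt]
  have : ∀ i ∈ J, HasFDerivAt (fun w : Vec d => loss (y i * inner ℝ (x i) w))
      (InnerProductSpace.toDual ℝ (Vec d)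
        (deriv loss (inner ℝ (y i • x i) w) • (y i • x i))) w := by
    intro i _
    have h1 : HasFDerivAt (fun w : Vec d => inner ℝ (y i • x i) w)
        (innerSL ℝ (y i • x i)) w := (innerSL ℝ (y i • x i)).hasFDerivAt
    have h2 := (hl (inner ℝ (y i • x i) w)).hasDerivAt.comp_hasFDerivAt w h1
    have e : (fun w : Vec d => loss (y i * inner ℝ (x i) w)) =
        loss ∘ fun w : Vec d => inner ℝ (y i • x i) w := by
      funext w; simp [real_inner_smul_left]
    rw [e]
    refine h2.congr_fderiv ?_
    ext v
    simp [real_inner_smul_left]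
  have h := HasFDerivAt.fun_sum this
  rw [← map_sum] at h
  exact h

theorem cyclicGD_succ {d N M : ℕ} [NeZero M] {loss : ℝ → ℝ} (hl : Differentiable ℝ loss)
    (x : Fin N → Vec d) (y : Fin N → ℝ) (I : Fin M → Finset (Fin N)) (η : ℝ) (K : ℕ)
    (w₀ : Vec d) (t k : ℕ) :
    cyclicGD loss x y I η K w₀ t (k + 1) = cyclicGD loss x y I η K w₀ t k +
      η • ∑ i ∈ I (cyclicTask M t),
        (-deriv loss (inner ℝ (y i • x i) (cyclicGD loss x y I η K w₀ t k))) • (y i • x i) := by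
  simp only [cyclicGD, seqGD]
  rw [Function.iterate_succ_apply']
  conv_lhs => rw [gdStep, gradient_trainLoss hl]
  simp only [neg_smul, Finset.sum_neg_distrib, smul_neg, sub_eq_add_neg]

theorem cyclicGD_next {d N M : ℕ} [NeZero M] (loss : ℝ → ℝ)
    (x : Fin N → Vec d) (y : Fin N → ℝ) (I : Fin M → Finset (Fin N)) (η : ℝ) (K : ℕ)
    (w₀ : Vec d) (t : ℕ) :
    cyclicGD loss x y I η K w₀ (t + 1) 0 = cyclicGD loss x y I η K w₀ t K := rfl

/-! ### The largest singular value of the data matrix -/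

theorem inner_mulVec_dataMatrix {d N : ℕ} (x : Fin N → Vec d) (v : Vec d) :
    inner ℝ (Matrix.toEuclideanLin (dataMatrix x * (dataMatrix x).transpose) v) v =
      ∑ i, inner ℝ (x i) v ^ 2 := by
  have h1 : ∀ i, ((dataMatrix x).transpose.mulVec v.ofLp) i = inner ℝ (x i) v := fun i => by
    simp [Matrix.mulVec, dotProduct, dataMatrix, PiLp.inner_apply, mul_comm]
  rw [real_inner_comm, EuclideanSpace.inner_eq_star_dotProduct, Matrix.ofLp_toLpLin,
    Matrix.toLin'_apply, ← Matrix.mulVec_mulVec, star_trivial, dotProduct_comm, Matrix.dotProduct_mulVec,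
    ← Matrix.mulVec_transpose, dotProduct]
  exact Finset.sum_congr rfl fun i _ => by rw [h1, sq]

/-- `‖Xᵀ v‖ ≤ σ_max ‖v‖`: the supremum of the Rayleigh quotient of `X Xᵀ` is an eigenvalue. -/
theorem sum_inner_sq_le_sigmaMax {d N : ℕ} (x : Fin N → Vec d) (v : Vec d) :
    ∑ i, inner ℝ (x i) v ^ 2 ≤ sigmaMax x ^ 2 * ‖v‖ ^ 2 := by
  rcases eq_or_ne v 0 with rfl | hv
  · simp
  have : Nontrivial (Vec d) := ⟨v, 0, hv⟩
  set A := dataMatrix x * (dataMatrix x).transpose with hA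
  have hsym : (Matrix.toEuclideanLin A).IsSymmetric := by
    rw [Matrix.isSymmetric_toEuclideanLin_iff, hA]
    simpa using Matrix.isHermitian_mul_conjTranspose_self (dataMatrix x)
  have heig := hsym.hasEigenvalue_iSup_of_finiteDimensional
  set l := ⨆ w : { w : Vec d // w ≠ 0 },
    RCLike.re (inner ℝ (Matrix.toEuclideanLin A w) (w : Vec d)) / ‖(w : Vec d)‖ ^ 2 with hl
  have hbdd : BddAbove (Set.range fun w : { w : Vec d // w ≠ 0 } =>
      RCLike.re (inner ℝ (Matrix.toEuclideanLin A w) (w : Vec d)) / ‖(w : Vec d)‖ ^ 2) := by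
    refine ⟨‖LinearMap.toContinuousLinearMap (Matrix.toEuclideanLin A)‖, ?_⟩
    rintro _ ⟨w, rfl⟩
    have hw : 0 < ‖(w : Vec d)‖ := norm_pos_iff.2 w.2
    simp only [RCLike.re_to_real]
    rw [div_le_iff₀ (by positivity)]
    calc _ ≤ ‖Matrix.toEuclideanLin A w‖ * ‖(w : Vec d)‖ := real_inner_le_norm _ _
      _ ≤ _ := by
        rw [sq, ← mul_assoc]
        gcongr
        exact (LinearMap.toContinuousLinearMap (Matrix.toEuclideanLin A)).le_opNorm _
  have h1 : (∑ i, inner ℝ (x i) v ^ 2) / ‖v‖ ^ 2 ≤ l := by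
    have := le_ciSup hbdd ⟨v, hv⟩
    refine le_trans (le_of_eq ?_) this
    rw [RCLike.re_to_real, hA, inner_mulVec_dataMatrix]
  have hl0 : 0 ≤ l := le_trans (by positivity) h1
  have heig' : Module.End.HasEigenvalue (Matrix.toLin' A) l := by
    obtain ⟨w, hw⟩ := heig.exists_hasEigenvector
    refine Module.End.hasEigenvalue_of_hasEigenvector (x := w.ofLp) ⟨?_, ?_⟩
    · have := hw.apply_eq_smul
      rw [Module.End.mem_eigenspace_iff]
      have h2 := congrArg (fun u : Vec d => u.ofLp) this
      simpa using h2
    · intro h0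
      exact hw.2 (by ext i; exact congrFun h0 i)
  have hfin : {l : ℝ | Module.End.HasEigenvalue (Matrix.toLin' A) l}.Finite := by
    refine (Module.End.finite_spectrum (Matrix.toLin' A)).subset fun l hl => ?_
    exact hl.mem_spectrum
  have h2 : l ≤ sigmaMax x ^ 2 := by
    have h3 : l ≤ sSup {l : ℝ | Module.End.HasEigenvalue (Matrix.toLin' A) l} :=
      le_csSup hfin.bddAbove heig'
    rw [sigmaMax, Real.sq_sqrt (hl0.trans h3)]
    exact h3
  have hv' : 0 < ‖v‖ := norm_pos_iff.2 hv
  rw [div_le_iff₀ (by positivity)] at h1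
  exact h1.trans (by gcongr)

/-! ### Maximum margin and support vectors -/

section Margin

variable {d N : ℕ} [NeZero N] {x : Fin N → Vec d} {y : Fin N → ℝ}

theorem maxMargin_ne_zero (h : JointlySeparable x y) : maxMargin x y ≠ 0 := by
  intro h0
  have := (maxMargin_spec h).1 0
  rw [h0, inner_zero_right, mul_zero] at this
  linarith

/-- Some constraint is active at the max-margin solution, since otherwise it could be scaled down; hence
`φ = 1 / ‖ŵ‖`. -/
theorem margin_eq_inv_norm (h : JointlySeparable x y) :
    margin x y = ‖maxMargin x y‖⁻¹ := by
  set w := maxMargin x y with hw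
  have hw0 : 0 < ‖w‖ := norm_pos_iff.2 (maxMargin_ne_zero h)
  obtain ⟨hfeas, hmin⟩ := maxMargin_spec h
  rw [← hw] at hfeas hmin
  obtain ⟨j, hj⟩ := exists_eq_ciInf_of_finite (f := fun i => y i * inner ℝ (x i) w / ‖w‖)
  have hle : ∀ i, y j * inner ℝ (x j) w ≤ y i * inner ℝ (x i) w := fun i => by
    have h1 : y j * inner ℝ (x j) w / ‖w‖ ≤ y i * inner ℝ (x i) w / ‖w‖ :=
      hj.le.trans (ciInf_le (Set.finite_range _).bddBelow i)
    exact (div_le_div_iff_of_pos_right hw0).1 h1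
  set m := y j * inner ℝ (x j) w with hm
  have hm1 : 1 ≤ m := hfeas j
  have hm0 : 0 < m := by linarith
  have h2 := hmin (m⁻¹ • w) fun i => by
    have := hle i
    rw [inner_smul_right]
    calc (1 : ℝ) = m⁻¹ * m := by field_simp
      _ ≤ m⁻¹ * (y i * inner ℝ (x i) w) := by gcongr
      _ = _ := by ring
  rw [norm_smul, Real.norm_of_nonneg (by positivity), mul_pow] at h2
  have h3 : 1 ≤ (m⁻¹) ^ 2 := by
    have : 0 < ‖w‖ ^ 2 := by positivity
    nlinarith
  have h4 : m ≤ 1 := by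
    rw [inv_pow, one_le_inv₀ (by positivity)] at h3
    nlinarith
  have hmeq : m = 1 := le_antisymm h4 hm1
  have : margin x y = m / ‖w‖ := hj.symm
  rw [this, hmeq, one_div]

theorem mem_supportIdx_iff (h : JointlySeparable x y) (i : Fin N) :
    i ∈ supportIdx x y ↔ y i * inner ℝ (x i) (maxMargin x y) = 1 := by
  have hw0 : 0 < ‖maxMargin x y‖ := norm_pos_iff.2 (maxMargin_ne_zero h)
  rw [supportIdx, Finset.mem_filter, margin_eq_inv_norm h, ← one_div, div_left_inj' hw0.ne']
  simp

theorem margin_mul_sum_le_norm (h : JointlySeparable x y) {c : Fin N → ℝ} (hc : ∀ i, 0 ≤ c i) :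
    margin x y * ∑ i, c i ≤ ‖∑ i, c i • (y i • x i)‖ := by
  have hw0 : 0 < ‖maxMargin x y‖ := norm_pos_iff.2 (maxMargin_ne_zero h)
  have h1 : ∑ i, c i ≤ inner ℝ (∑ i, c i • (y i • x i)) (maxMargin x y) := by
    rw [sum_inner]
    refine Finset.sum_le_sum fun i _ => ?_
    rw [real_inner_smul_left, real_inner_smul_left]
    exact le_mul_of_one_le_right (hc i) ((maxMargin_spec h).1 i)
  rw [margin_eq_inv_norm h, inv_mul_le_iff₀ hw0, mul_comm]
  exact h1.trans (real_inner_le_norm _ _)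

end Margin

/-- Inner products with linearly independent vectors can be prescribed. -/
theorem exists_inner_eq_of_injective {V S : Type*} [NormedAddCommGroup V] [InnerProductSpace ℝ V]
    [FiniteDimensional ℝ V] [Fintype S] {z : S → V}
    (hz : ∀ c : S → ℝ, ∑ i, c i • z i = 0 → c = 0) (t : S → ℝ) :
    ∃ v, ∀ i, inner ℝ (z i) v = t i := by
  classical
  obtain ⟨L, hL⟩ := (Fintype.linearCombination ℝ z).exists_leftInverse_of_injective
    (LinearMap.ker_eq_bot'.2 fun c hc => hz c (by simpa [Fintype.linearCombination_apply] using hc))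
  let f : V →ₗ[ℝ] ℝ := (Fintype.linearCombination ℝ t).comp L
  refine ⟨(InnerProductSpace.toDual ℝ V).symm (LinearMap.toContinuousLinearMap f), fun i => ?_⟩
  rw [real_inner_comm, InnerProductSpace.toDual_symm_apply]
  have h1 : L (z i) = Pi.single i 1 := by
    have := LinearMap.congr_fun hL (Pi.single i 1)
    simpa using this
  simp [f, h1]

/-- Uniqueness of the positive coefficients makes the signed support vectors linearly independent: a
relation between them, scaled down, could be added to the coefficients. -/
theorem NonDegenerateSupport.eq_zero_of_sum_eq_zero {d N : ℕ} {x : Fin N → Vec d} {y : Fin N → ℝ}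
    (h : NonDegenerateSupport x y) (c : supportIdx x y → ℝ)
    (hc : ∑ i, c i • (y i • x i) = 0) : c = 0 := by
  obtain ⟨α, ⟨hpos, hsum⟩, huniq⟩ := h
  have hev : ∀ᶠ ε : ℝ in 𝓝[>] 0, ∀ i, 0 < α i + ε * c i := by
    refine eventually_all.2 fun i => ?_
    have : Tendsto (fun ε : ℝ => α i + ε * c i) (𝓝[>] 0) (𝓝 (α i + 0 * c i)) :=
      (Continuous.tendsto (by fun_prop) 0).mono_left nhdsWithin_le_nhds
    exact this.eventually_const_lt (by simpa using hpos i)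
  obtain ⟨ε, hε, hε0⟩ := (hev.and self_mem_nhdsWithin).exists
  have h1 := huniq (fun i => α i + ε * c i) ⟨hε, by
    have e : ∑ i : supportIdx x y, ((α i + ε * c i) * y i) • x i =
        ∑ i : supportIdx x y, (α i * y i) • x i + ε • ∑ i, c i • (y i • x i) := by
      rw [Finset.smul_sum, ← Finset.sum_add_distrib]
      refine Finset.sum_congr rfl fun i _ => ?_
      rw [smul_smul, smul_smul, ← add_smul]; ring_nf
    rw [e, hc, smul_zero, add_zero, ← hsum]⟩
  funext i
  have h2 := congrFun h1 i
  have h3 : ε * c i = 0 := by simpa using h2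
  rcases mul_eq_zero.1 h3 with h4 | h4
  · exact absurd h4 (ne_of_gt hε0)
  · exact h4

/-- The coefficients of the max-margin solution, extended by zero outside the support, with a vector `v`
that realizes them as `α i = s exp (-⟪z i, v⟫)` on the support. -/
theorem NonDegenerateSupport.exists_dual_certificate {d N : ℕ} [NeZero N] {x : Fin N → Vec d}
    {y : Fin N → ℝ} (h : NonDegenerateSupport x y) (hsep : JointlySeparable x y) {s : ℝ}
    (hs : 0 < s) : ∃ (α : Fin N → ℝ) (v : Vec d), maxMargin x y = ∑ i, α i • (y i • x i) ∧
      ∀ i, (α i = s * Real.exp (-inner ℝ (y i • x i) v) ∧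
          inner ℝ (y i • x i) (maxMargin x y) = 1) ∨
        (α i = 0 ∧ 1 < inner ℝ (y i • x i) (maxMargin x y)) := by
  classical
  obtain ⟨v, hv⟩ : ∃ v, ∀ i : supportIdx x y, inner ℝ (y i • x i) v =
      -Real.log (h.choose i / s) :=
    exists_inner_eq_of_injective h.eq_zero_of_sum_eq_zero _
  obtain ⟨⟨hpos, hsum⟩, -⟩ := h.choose_spec
  set α := h.choose
  set α' : Fin N → ℝ := fun i => if hi : i ∈ supportIdx x y then α ⟨i, hi⟩ else 0 with hα'
  have hmem : ∀ i (hi : i ∈ supportIdx x y), α' i = α ⟨i, hi⟩ := fun i hi => dif_pos hi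
  have hnot : ∀ i, i ∉ supportIdx x y → α' i = 0 := fun i hi => dif_neg hi
  refine ⟨α', v, ?_, fun i => ?_⟩
  · rw [hsum, ← Finset.sum_subset (Finset.subset_univ (supportIdx x y)),
      ← Finset.sum_coe_sort (supportIdx x y) fun i => α' i • (y i • x i)]
    · refine Finset.sum_congr rfl fun i _ => ?_
      rw [hmem i i.2, smul_smul]
    · intro i _ hi
      rw [hnot i hi, zero_smul]
  · by_cases hi : i ∈ supportIdx x y
    · left
      rw [hmem i hi]
      refine ⟨?_, ?_⟩
      · rw [hv ⟨i, hi⟩, neg_neg, Real.exp_log (div_pos (hpos _) hs)]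
        field_simp
      · rw [real_inner_smul_left]; exact (mem_supportIdx_iff hsep i).1 hi
    · right
      refine ⟨hnot i hi, lt_of_le_of_ne ?_ ?_⟩
      · rw [real_inner_smul_left]; exact (maxMargin_spec hsep).1 i
      · rw [real_inner_smul_left]
        exact fun h => hi ((mem_supportIdx_iff hsep i).2 h.symm)

/-! ### Convergence of the iterates -/

theorem tendsto_normalize_of_norm_sub_log_smul_le {V : Type*} [NormedAddCommGroup V]
    [NormedSpace ℝ V] {a : ℕ → V} {w : V} {B : ℝ} (hw : w ≠ 0)
    (h : ∀ᶠ t : ℕ in atTop, ‖a t - Real.log t • w‖ ≤ B) :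
    Tendsto (fun t => ‖a t‖⁻¹ • a t) atTop (𝓝 (‖w‖⁻¹ • w)) := by
  have hlog : Tendsto (fun t : ℕ => Real.log t) atTop atTop :=
    Real.tendsto_log_atTop.comp tendsto_natCast_atTop_atTop
  have h1 : Tendsto (fun t : ℕ => (Real.log t)⁻¹ • a t) atTop (𝓝 w) := by
    rw [tendsto_iff_norm_sub_tendsto_zero]
    have h2 : Tendsto (fun t : ℕ => (Real.log t)⁻¹ * B) atTop (𝓝 0) := by
      simpa using hlog.inv_tendsto_atTop.mul_const B
    refine squeeze_zero' (Eventually.of_forall fun _ => norm_nonneg _) ?_ h2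
    filter_upwards [h, hlog.eventually_gt_atTop 0] with t ht hl
    have e : (Real.log t)⁻¹ • a t - w = (Real.log t)⁻¹ • (a t - Real.log t • w) := by
      rw [smul_sub, smul_smul, inv_mul_cancel₀ hl.ne', one_smul]
    rw [e, norm_smul, Real.norm_of_nonneg (by positivity)]
    gcongr
  refine ((h1.norm.inv₀ (norm_ne_zero_iff.2 hw)).smul h1).congr' ?_
  filter_upwards [hlog.eventually_gt_atTop 0] with t hl
  rw [norm_smul, Real.norm_of_nonneg (by positivity), smul_smul]
  congr 1
  field_simp

/-- The bound on the learning rate implies the step-size condition of `LossShape.cycle_descent`; it uses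
`φ ≤ σ` to replace `β σ²` by `β σ⁴ / φ²`. -/
theorem learningRate_bound {η K M β σ φ : ℝ} (hη : 0 < η) (hK : 0 < K) (hβ : 0 < β)
    (hM : 0 ≤ M) (hφ : 0 < φ) (hφσ : φ ≤ σ)
    (h : η < φ ^ 2 / (2 * K * β * σ ^ 3 * (M * φ + σ))) :
    M * β * σ ^ 3 / φ + β * σ ^ 2 ≤ 1 / (2 * (K * η)) := by
  have hσ : 0 < σ := hφ.trans_le hφσ
  rw [lt_div_iff₀ (by positivity)] at h
  have h1 : β * σ ^ 2 ≤ β * σ ^ 4 / φ ^ 2 := by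
    rw [le_div_iff₀ (by positivity)]
    have : φ ^ 2 ≤ σ ^ 2 := by gcongr
    nlinarith [mul_le_mul_of_nonneg_left this (show 0 ≤ β * σ ^ 2 by positivity)]
  refine (add_le_add_right h1 _).trans ?_
  have e : M * β * σ ^ 3 / φ + β * σ ^ 4 / φ ^ 2 = β * σ ^ 3 * (M * φ + σ) / φ ^ 2 := by
    field_simp
  rw [e, div_le_div_iff₀ (by positivity) (by positivity)]
  linarith

/-- The bound for the iterates in terms of cycles: `u n` is the start of cycle `n`, and the other data
are as in `LossShape.cycle_descent`. -/
theorem LossShape.exists_bound_of_cycles {V ι κ : Type*} [NormedAddCommGroup V]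
    [InnerProductSpace ℝ V] [Fintype ι] [Fintype κ] [DecidableEq κ]
    {loss : ℝ → ℝ} {β : ℝ} (h : LossShape loss β) (htail : TightExponentialTail loss)
    {z : ι → V} {τ : ι → κ} {σ φ η : ℝ} {K : ℕ} (hσ : 0 ≤ σ) (hφ : 0 < φ) (hη : 0 < η)
    (hK : 1 ≤ K) (hz : ∀ v, ∑ i, inner ℝ (z i) v ^ 2 ≤ σ ^ 2 * ‖v‖ ^ 2)
    (hmargin : ∀ c : ι → ℝ, (∀ i, 0 ≤ c i) → φ * ∑ i, c i ≤ ‖∑ i, c i • z i‖)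
    (hstep : Fintype.card κ * β * σ ^ 3 / φ + β * σ ^ 2 ≤ 1 / (2 * (K * η)))
    {u : ℕ → V} {P : ℕ → κ → ℕ → V} {c : ℕ → ι → ℝ}
    (hc : ∀ n i, c n i = ∑ k ∈ Finset.range K, -deriv loss (inner ℝ (z i) (P n (τ i) k)))
    (hu : ∀ n, u (n + 1) = u n + η • ∑ i, c n i • z i)
    (hP : ∀ n m, ∀ k < K, ‖P n m k - u n‖ ≤ η * σ * ∑ i, c n i)
    {w : V} (hw : ∃ (α : ι → ℝ) (v : V), w = ∑ i, α i • z i ∧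
      ∀ i, (α i = η * K * Real.exp (-inner ℝ (z i) v) ∧ inner ℝ (z i) w = 1) ∨
        (α i = 0 ∧ 1 < inner ℝ (z i) w)) :
    ∃ B, ∀ n, ∀ m, ∀ k < K, ‖P n m k - Real.log (n + 1) • w‖ ≤ B := by
  have hKpos : (0 : ℝ) < K := by exact_mod_cast hK
  have hc0 : ∀ n i, 0 ≤ c n i := fun n i => by
    rw [hc]
    exact Finset.sum_nonneg fun k _ => by linarith [h.deriv_neg (inner ℝ (z i) (P n (τ i) k))]
  -- `δ n` measures the length of cycle `n`; the descent makes it square summable.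
  set δ : ℕ → ℝ := fun n => ∑ i, c n i with hδ
  have hδ0 : ∀ n, 0 ≤ δ n := fun n => Finset.sum_nonneg fun i _ => hc0 n i
  have hcδ : ∀ n i, c n i ≤ δ n := fun n i =>
    Finset.single_le_sum (f := c n) (fun j _ => hc0 n j) (Finset.mem_univ i)
  have hsumD : Summable fun n => ‖u (n + 1) - u n‖ ^ 2 :=
    summable_sq_norm_of_descent (F := fun n => ∑ i, loss (inner ℝ (z i) (u n)))
      (c := 1 / (2 * (K * η))) (by positivity)
      (fun n => Finset.sum_nonneg fun i _ => (h.pos _).le)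
      (fun n => h.cycle_descent hσ hφ hη hK hz hmargin hstep (hc n) (hu n) (hP n))
  have hδD : ∀ n, δ n ≤ (η * φ)⁻¹ * ‖u (n + 1) - u n‖ := fun n => by
    rw [le_inv_mul_iff₀ (by positivity), hu n, add_sub_cancel_left, norm_smul,
      Real.norm_of_nonneg hη.le, mul_assoc]
    exact mul_le_mul_of_nonneg_left (hmargin _ (hc0 n)) hη.le
  have hsumδ : Summable fun n => δ n ^ 2 := by
    refine Summable.of_nonneg_of_le (fun n => sq_nonneg _) (fun n => ?_)
      (hsumD.mul_left ((η * φ)⁻¹ ^ 2))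
    rw [← mul_pow]
    exact pow_le_pow_left₀ (hδ0 n) (hδD n) 2
  have hδlim : Tendsto δ atTop (𝓝 0) := by
    have := (Real.continuous_sqrt.tendsto 0).comp hsumδ.tendsto_atTop_zero
    rw [Real.sqrt_zero] at this
    exact this.congr fun n => Real.sqrt_sq (hδ0 n)
  have hzσ := norm_le_of_sum_inner_sq_le hσ hz
  have hpq : ∀ i n, ∀ k < K, |inner ℝ (z i) (P n (τ i) k) - inner ℝ (z i) (u n)| ≤
      σ * (η * σ) * δ n := fun i n k hk => by
    rw [← inner_sub_right, mul_assoc]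
    refine (abs_real_inner_le_norm _ _).trans ?_
    exact mul_le_mul (hzσ i) (hP n (τ i) k hk) (norm_nonneg _) hσ
  -- The derivatives at the iterates tend to zero, so the margins tend to infinity.
  have hq : ∀ i, Tendsto (fun n => inner ℝ (z i) (u n)) atTop atTop := fun i => by
    have h1 : Tendsto (fun n => -deriv loss (inner ℝ (z i) (P n (τ i) 0))) atTop (𝓝 0) := by
      refine squeeze_zero (fun n => by linarith [h.deriv_neg (inner ℝ (z i) (P n (τ i) 0))])
        (fun n => ?_) hδlim
      refine le_trans ?_ (hcδ n i)
      rw [hc]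
      exact Finset.single_le_sum (f := fun k => -deriv loss (inner ℝ (z i) (P n (τ i) k)))
        (fun k _ => by linarith [h.deriv_neg (inner ℝ (z i) (P n (τ i) k))])
        (Finset.mem_range.2 hK)
    have h2 := (h.tendsto_atTop_of_deriv_tendsto_zero h1).atTop_add
      (hδlim.const_mul (-(σ * (η * σ))))
    refine tendsto_atTop_mono (fun n => ?_) h2
    linarith [(abs_le.1 (hpq i n 0 hK)).2]
  obtain ⟨μ, U, hμ, htl⟩ := htail.exists_abs_sub_le
  obtain ⟨α, v, hwα, hα⟩ := hw
  obtain ⟨B, hB⟩ := exists_norm_sub_log_smul_le (B₀ := η * σ) hη hKpos hμ hsumδ hu (fun n => by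
      rw [hu n, add_sub_cancel_left, norm_smul, Real.norm_of_nonneg hη.le, mul_assoc,
        mul_comm σ, hδ, Finset.sum_mul]
      gcongr
      refine norm_sum_le_of_le _ fun i _ => ?_
      rw [norm_smul, Real.norm_of_nonneg (hc0 n i)]
      exact mul_le_mul_of_nonneg_left (hzσ i) (hc0 n i)) hc0 hq (fun i => by
      simp only [hc]
      exact eventually_abs_sum_sub_mul_exp_neg_le hμ (fun u => by linarith [h.deriv_neg u]) htl
        hK (by positivity) (hq i) hδ0 hδlim (hpq i) fun n => (hc n i) ▸ hcδ n i) hwα hα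
  obtain ⟨Δ, hΔ⟩ := hδlim.bddAbove_range
  refine ⟨η * σ * Δ + B, fun n m k hk => ?_⟩
  have h1 : ‖P n m k - u n‖ ≤ η * σ * Δ :=
    (hP n m k hk).trans (mul_le_mul_of_nonneg_left (hΔ ⟨n, rfl⟩) (by positivity))
  calc _ ≤ ‖P n m k - u n‖ + ‖u n - Real.log (n + 1) • w‖ := norm_sub_le_norm_sub_add_norm_sub _ _ _
    _ ≤ _ := add_le_add h1 (hB n)

/-- Counting cycles instead of stages changes the logarithm by a bounded amount. -/
theorem abs_log_div_add_one_sub_log_le {M : ℕ} (hM : 0 < M) {t : ℕ} (ht : 1 ≤ t) :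
    |Real.log ((t / M : ℕ) + 1) - Real.log t| ≤ Real.log 2 + Real.log M := by
  have ht' : (1 : ℝ) ≤ t := by exact_mod_cast ht
  have hM' : (1 : ℝ) ≤ M := by exact_mod_cast hM
  have h1 : ((t / M : ℕ) : ℝ) + 1 ≤ 2 * t := by
    have : ((t / M : ℕ) : ℝ) ≤ t := by exact_mod_cast Nat.div_le_self t M
    linarith
  have h2 : (t : ℝ) ≤ M * ((t / M : ℕ) + 1) := by
    exact_mod_cast (Nat.lt_mul_div_succ t hM).le
  have h3 := Real.log_le_log (by positivity) h1
  have h4 := Real.log_le_log (by positivity) h2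
  rw [Real.log_mul (by norm_num) (by positivity)] at h3
  rw [Real.log_mul (by positivity) (by positivity)] at h4
  have h5 := Real.log_nonneg hM'
  have h6 := Real.log_nonneg (show (1 : ℝ) ≤ 2 by norm_num)
  rw [abs_le]
  constructor <;> linarith

theorem exists_norm_cyclicGD_sub_log_smul_le {d N M : ℕ} [NeZero N] [NeZero M]
    (x : Fin N → Vec d) (y : Fin N → ℝ) (hy : ∀ i, y i = 1 ∨ y i = -1)
    (I : Fin M → Finset (Fin N)) (hI : IsTaskPartition I)
    (loss : ℝ → ℝ) (β : ℝ) (K : ℕ) (hK : 1 ≤ K) (η : ℝ) (hη : 0 < η) (w₀ : Vec d)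
    (hsep : JointlySeparable x y) (hnd : NonDegenerateSupport x y)
    (hloss : LossShape loss β) (htail : TightExponentialTail loss)
    (hlr : η < margin x y ^ 2 /
      (2 * K * β * sigmaMax x ^ 3 * (M * margin x y + sigmaMax x))) :
    ∃ B, ∀ t ≥ 1, ∀ k < K,
      ‖cyclicGD loss x y I η K w₀ t k - Real.log t • maxMargin x y‖ ≤ B := by
  have hKpos : (0 : ℝ) < K := by exact_mod_cast hK
  -- `τ i` is the task that contains `i`.
  choose τ hτ hτu using hI
  have hIτ : ∀ m, I m = Finset.univ.filter fun i => τ i = m := fun m => by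
    ext i
    simp only [Finset.mem_filter, Finset.mem_univ, true_and]
    exact ⟨fun hi => (hτu i m hi).symm, fun hi => hi ▸ hτ i⟩
  set z : Fin N → Vec d := fun i => y i • x i with hzdef
  set W := cyclicGD loss x y I η K w₀ with hW
  set g : ℕ → ℕ → Fin N → ℝ := fun t k i => -deriv loss (inner ℝ (z i) (W t k)) with hg
  have hg0 : ∀ t k i, 0 ≤ g t k i := fun t k i => by
    linarith [hloss.deriv_neg (inner ℝ (z i) (W t k))]
  set w := maxMargin x y
  set σ := sigmaMax x
  have hw0 : 0 < ‖w‖ := norm_pos_iff.2 (maxMargin_ne_zero hsep)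
  have hφ : 0 < margin x y := by rw [margin_eq_inv_norm hsep]; positivity
  have hσ0 : 0 ≤ σ := Real.sqrt_nonneg _
  have hz : ∀ v, ∑ i, inner ℝ (z i) v ^ 2 ≤ σ ^ 2 * ‖v‖ ^ 2 := fun v => by
    refine le_trans (le_of_eq ?_) (sum_inner_sq_le_sigmaMax x v)
    refine Finset.sum_congr rfl fun i _ => ?_
    rw [hzdef, real_inner_smul_left, mul_pow]
    rcases hy i with h | h <;> simp [h]
  have hzσ := norm_le_of_sum_inner_sq_le hσ0 hz
  have hφσ : margin x y ≤ σ := by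
    have h1 : 1 ≤ inner ℝ (z 0) w := by
      rw [hzdef, real_inner_smul_left]; exact (maxMargin_spec hsep).1 0
    rw [margin_eq_inv_norm hsep, inv_le_iff_one_le_mul₀ hw0]
    exact h1.trans ((real_inner_le_norm _ _).trans
      (mul_le_mul_of_nonneg_right (hzσ 0) hw0.le))
  -- For `β = 0` the bound on `η` is a division by zero, hence `η < 0`.
  have hβ : 0 < β := by
    refine hloss.smoothness_nonneg.lt_of_ne fun h0 => ?_
    rw [← h0] at hlr
    simp at hlr
    linarith
  have hstep : (Fintype.card (Fin M) : ℝ) * β * σ ^ 3 / margin x y + β * σ ^ 2 ≤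
      1 / (2 * (K * η)) := by
    rw [Fintype.card_fin]
    exact learningRate_bound hη hKpos hβ (Nat.cast_nonneg M) hφ hφσ hlr
  set G : ℕ → ℕ → Vec d := fun t k => η • ∑ i with τ i = cyclicTask M t, g t k i • z i with hG
  have hWstep : ∀ t k, W t (k + 1) = W t k + G t k := fun t k => by
    rw [hW, cyclicGD_succ hloss.differentiable, hIτ]
  have hWnext : ∀ t, W (t + 1) 0 = W t K := cyclicGD_next loss x y I η K w₀
  have hGnorm : ∀ t k, ‖G t k‖ ≤ η * σ * ∑ i with τ i = cyclicTask M t, g t k i := fun t k => by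
    rw [hG, norm_smul, Real.norm_of_nonneg hη.le, mul_assoc, Finset.mul_sum]
    refine mul_le_mul_of_nonneg_left (norm_sum_le_of_le _ fun i _ => ?_) hη.le
    rw [norm_smul, Real.norm_of_nonneg (hg0 t k i), mul_comm]
    exact mul_le_mul_of_nonneg_right (hzσ i) (hg0 t k i)
  obtain ⟨B, hB⟩ := hloss.exists_bound_of_cycles (κ := Fin M) (τ := τ) (z := z)
    (u := fun n => W (n * M) 0) (P := fun n m k => W (n * M + m) k)
    (c := fun n i => ∑ k ∈ Finset.range K, g (n * M + τ i) k i) htail hσ0 hφ hη hK hz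
    (fun c hc => margin_mul_sum_le_norm hsep hc) hstep (fun n i => rfl)
    (fun n => by
      rw [add_mul, one_mul, start_eq_start_add hWstep hWnext]
      simp only [hG, ← Finset.smul_sum]
      rw [sum_cycle_eq_sum_data τ n fun t k i => g t k i • z i]
      simp only [Finset.sum_smul])
    (fun n m k hk => by
      refine (norm_stage_sub_start_le hWstep hWnext hGnorm m.2 hk.le).trans_eq ?_
      simp only [← Finset.mul_sum]
      rw [sum_cycle_eq_sum_data τ n g])
    (hnd.exists_dual_certificate hsep (mul_pos hη hKpos))
  refine ⟨B + (Real.log 2 + Real.log M) * ‖w‖, fun t ht k hk => ?_⟩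
  have hM : 0 < M := NeZero.pos M
  have ht' : t / M * M + (⟨t % M, Nat.mod_lt t hM⟩ : Fin M) = t := Nat.div_add_mod' t M
  have h1 := hB (t / M) ⟨t % M, Nat.mod_lt t hM⟩ k hk
  rw [ht'] at h1
  have h2 : ‖Real.log ((t / M : ℕ) + 1) • w - Real.log t • w‖ ≤
      (Real.log 2 + Real.log M) * ‖w‖ := by
    rw [← sub_smul, norm_smul, Real.norm_eq_abs]
    exact mul_le_mul_of_nonneg_right (abs_log_div_add_one_sub_log_le hM ht) hw0.le
  exact (norm_sub_le_norm_sub_add_norm_sub _ _ _).trans (add_le_add h1 h2)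

theorem theorem3p2 {d N M : ℕ} [NeZero N] [NeZero M]
    (x : Fin N → Vec d) (y : Fin N → ℝ) (hy : ∀ i, y i = 1 ∨ y i = -1)
    (I : Fin M → Finset (Fin N)) (hI : IsTaskPartition I)
    (loss : ℝ → ℝ) (β : ℝ) (K : ℕ) (hK : 1 ≤ K) (η : ℝ) (hη : 0 < η) (w₀ : Vec d)
    (hsep : JointlySeparable x y)
    (hnd : NonDegenerateSupport x y)
    (hloss : LossShape loss β)
    (htail : TightExponentialTail loss)
    (hlr : η < margin x y ^ 2 /
      (2 * K * β * sigmaMax x ^ 3 * (M * margin x y + sigmaMax x))) :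
    (∃ (ρ : ℕ → ℕ → Vec d) (B : ℝ) (T : ℕ), ∀ t ≥ T, ∀ k < K,
      cyclicGD loss x y I η K w₀ t k = Real.log t • maxMargin x y + ρ t k ∧ ‖ρ t k‖ ≤ B) ∧
    (∀ k < K, Tendsto
      (fun t : ℕ => ‖cyclicGD loss x y I η K w₀ t k‖⁻¹ • cyclicGD loss x y I η K w₀ t k)
      atTop (𝓝 (‖maxMargin x y‖⁻¹ • maxMargin x y))) := by
  obtain ⟨B, hB⟩ := exists_norm_cyclicGD_sub_log_smul_le x y hy I hI loss β K hK η hη w₀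
    hsep hnd hloss htail hlr
  refine ⟨⟨fun t k => cyclicGD loss x y I η K w₀ t k - Real.log t • maxMargin x y, B, 1,
    fun t ht k hk => ⟨(add_sub_cancel _ _).symm, hB t ht k hk⟩⟩, fun k hk => ?_⟩
  exact tendsto_normalize_of_norm_sub_log_smul_le (maxMargin_ne_zero hsep)
    (eventually_atTop.2 ⟨1, fun t ht => hB t ht k hk⟩)
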